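/- **Setting.** Let $(\mathcal X,\mathcal B)$ be a measurable space, $X=\{X_n\}_{n\ge1}$ an $\mathcal X$-valued random process, and $P$ a probability kernel from $\mathcal X$ to $\mathbb R$; write $F_x$ for the distribution function of $P(x,\cdot)$. For $n\ge1$ let $\{\xi_n^x\}_{x\in\mathcal X}$ be families of real random variables, jointly measurable in $(x,\omega)$, mutually independent in $n$ and jointly independent of $X$, such that each $\xi_n^x$ has distribution $F_x$. (Precisely: there are $\sigma$-algebras $\mathcal G_n$, $n\ge1$, mutually independent and jointly independent of $\sigma(X)$, such that $(x,\omega)\mapsto\xi_n^x(\omega)$ is $\mathcal B\otimes\mathcal G_n$-measurable for each $n$.) Put $$S_0=0,\quad S_n=\sum_{i=1}^n\xi_i^{X_i},\quad M=\sup_{n\ge0}S_n,\quad \mu(y)=\min\{n\ge1:\ S_n>y\}\quad(y>0).$$ For a distribution $H$ on $\mathbb R$ let $\overline H(y)=1-H(y)$, and let $H^s$ be the distribution with tail $\overline H^s(y)=\min\bigl(1,\int_y^\infty\overline H(t)\,dt\bigr)$. A distribution $H$ on $[0,\infty)$ is *subexponential* if $\overline H(y)>0$ for all $y$ and $\overline{H^{*2}}(y)/\overline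 H(y)\to2$ as $y\to\infty$; a distribution on $\mathbb R$ is called subexponential if the law of the positive part of a random variable with that distribution is subexponential. Assume that every $F_x$ has a finite mean, and that there are a distribution $F$ on $[0,\infty)$ with finite mean, a measurable function $c:\mathcal X\to[0,\infty)$ and a constant $L<\infty$ such that $$\overline F_x(y)\sim c(x)\overline F(y)\ \text{ as }y\to\infty,\ \text{ for all }x\in\mathcal X,\qquad \overline F_x(y)\le L\,\overline F(y)\ \text{ for all }x\in\mathcal X,\ y\ge0,$$ where for $c(x)=0$ the first relation means $\overline F_x(y)=o(\overline F(y))$. **Theorem.** Assume further that: * (C1) there are a probability measure $\pi$ on $(\mathcal X,\mathcal B)$ and a positive integer $d$ such that $\frac1d\sum_{j=0}^{d-1}\mathbf P(X_{n+j}\in\cdot)\to\pi$ in total variation as $n\to\infty$; * (C2) $S_n/n\to-a$ almost surely as $n\to\infty$, for some constant $a>0$; * $F^s$ is subexponential; * there is a distribution $G$ on $\mathbb R$ with negative mean $\int t\,dG(t)<0$ such that $\overline F_x(y)\le\overline G(y)$ for all $x\in\mathcal X$ and $y\in\mathbb R$. Then, with $C(B)=\int_Bc(x)\,\pi(dx)$,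 $$\lim_{y\to\infty}\frac{\mathbf P(M>y,\ X_{\mu(y)}\in B)}{\overline F^s(y)}=\frac{C(B)}a\qquad\text{for every }B\in\mathcal B.$$ -/

import Mathlib

open MeasureTheory ProbabilityTheory Filter Topology Set
open scoped ENNReal Asymptotics

noncomputable section

namespace ModulatedWalk

/-! Distributions on `ℝ` are probability measures on the Borel sets of `ℝ`. -/

/-- The tail `H̄(y) = 1 - H(y) = H((y, ∞))` of a distribution `H` on `ℝ`. -/
def tail (H : Measure ℝ) (y : ℝ) : ℝ := H.real (Ioi y)

/-- `min (1, ∫_y^∞ H̄(t) dt)`, the tail of the integrated (second-tail) distribution of `H`. -/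
def secondTail (H : Measure ℝ) (y : ℝ) : ℝ :=
  (min 1 (∫⁻ t in Ioi y, H (Ioi t))).toReal

theorem secondTail_antitone (H : Measure ℝ) : Antitone (secondTail H) := by
  intro x y hxy
  refine ENNReal.toReal_mono (by simp) (min_le_min_left _ ?_)
  exact lintegral_mono_set (Ioi_subset_Ioi hxy)

theorem secondTail_rightContinuous (H : Measure ℝ) (x : ℝ) :
    ContinuousWithinAt (secondTail H) (Ici x) x := by
  rw [← continuousWithinAt_Ioi_iff_Ici]
  set ν : Measure ℝ := volume.withDensity (fun t => H (Ioi t)) with hν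
  have hφ : ∀ y, ∫⁻ t in Ioi y, H (Ioi t) = ν (Ioi y) := fun y =>
    (withDensity_apply _ measurableSet_Ioi).symm
  have key : Tendsto (fun y => ν (Ioi y)) (𝓝[>] x) (𝓝 (ν (Ioi x))) := by
    obtain ⟨u, hu, hux, hul⟩ := exists_seq_strictAnti_tendsto x
    have hUn : ⋃ n, Ioi (u n) = Ioi x := by
      ext z
      simp only [mem_iUnion, mem_Ioi]
      constructor
      · rintro ⟨n, hn⟩
        exact (hux n).trans hn
      · intro hz
        exact (hul.eventually (gt_mem_nhds hz)).exists
    have hlim : Tendsto (fun n => ν (Ioi (u n))) atTop (𝓝 (ν (Ioi x))) := by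
      have h := tendsto_measure_iUnion_atTop (μ := ν) (s := fun n => Ioi (u n))
        (fun i j hij => Ioi_subset_Ioi (hu.antitone hij))
      rwa [hUn] at h
    refine tendsto_order.2 ⟨fun a ha => ?_, fun a ha => ?_⟩
    · obtain ⟨n, hn⟩ := (hlim.eventually (lt_mem_nhds ha)).exists
      filter_upwards [Ioo_mem_nhdsGT (hux n)] with y hy
      exact hn.trans_le (measure_mono (Ioi_subset_Ioi hy.2.le))
    · filter_upwards [self_mem_nhdsWithin] with y hy
      exact (measure_mono (Ioi_subset_Ioi (le_of_lt hy))).trans_lt ha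
  have h1 : Tendsto (fun y => min 1 (ν (Ioi y))) (𝓝[>] x) (𝓝 (min 1 (ν (Ioi x)))) :=
    tendsto_const_nhds.min key
  have h2 : secondTail H = fun y => (min 1 (ν (Ioi y))).toReal :=
    funext fun y => by rw [secondTail, hφ y]
  rw [h2]
  exact (ENNReal.tendsto_toReal (by simp)).comp h1

/-- The distribution function `y ↦ 1 - min (1, ∫_y^∞ H̄(t) dt)` of the second-tail distribution. -/
def secondTailCDF (H : Measure ℝ) : StieltjesFunction ℝ where
  toFun y := 1 - secondTail H y
  mono' _ _ h := sub_le_sub_left (secondTail_antitone H h) 1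
  right_continuous' x := continuousWithinAt_const.sub (secondTail_rightContinuous H x)

/-- The integrated, or second-tail, distribution `H^s`. -/
def secondTailDist (H : Measure ℝ) : Measure ℝ := (secondTailCDF H).measure

/-- The law of the positive part `max (ζ, 0)` of a random variable `ζ` with law `H`; it is `H`
itself when `H` is carried by `[0, ∞)`. -/
def positivePart (H : Measure ℝ) : Measure ℝ := H.map (fun t => max t 0)

/-- Subexponentiality: `H̄ > 0` everywhere and `H̄^{*2}(y) / H̄(y) → 2`. The ratio condition is
imposed on the positive part of `H`, which is `H` itself for distributions on `[0, ∞)`. -/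
def Subexponential (H : Measure ℝ) : Prop :=
  (∀ y, 0 < tail H y) ∧
    Tendsto (fun y => tail ((positivePart H).conv (positivePart H)) y / tail (positivePart H) y)
      atTop (𝓝 2)

/-- The total variation distance `sup_B |μ(B) - ν(B)|` of two finite measures, the supremum being
over all measurable sets. -/
def tvDist {E : Type*} [MeasurableSpace E] (μ ν : Measure E) : ℝ :=
  ⨆ B : {B : Set E // MeasurableSet B}, |μ.real B - ν.real B|

section Walk

variable {E Ω : Type*} [mE : MeasurableSpace E] [mΩ : MeasurableSpace Ω]

/-- Processes are indexed by `n ≥ 1`; the value at index `0` is never used.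
`X 1, X 2, …` is an `E`-valued random process and `ξ n x` (`n ≥ 1`, `x ∈ E`) are real random
variables such that
* `ξ n x` has law `P x`;
* the families `(ξ n x)_{x ∈ E}` are mutually independent in `n`, and jointly independent of `X`.

As the family `(ξ n x)_x` is to be evaluated at the random point `X n`, its randomness is carried
by a `σ`-algebra `𝒢 n` for which it is jointly measurable in `x` and `ω`, and the independence is
that of the `𝒢 n`, `n ≥ 1`, and of `σ(X 1, X 2, …)`. -/
structure IsModulated (Pr : Measure Ω) (P : Kernel E ℝ) (X : ℕ → Ω → E) (ξ : ℕ → E → Ω → ℝ) :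
    Prop where
  measurable_X : ∀ n, 1 ≤ n → Measurable (X n)
  law : ∀ n, 1 ≤ n → ∀ x, Pr.map (ξ n x) = P x
  indep : ∃ 𝒢 : ℕ+ → MeasurableSpace Ω,
    (∀ n, 𝒢 n ≤ mΩ) ∧
    (∀ n, Measurable[mE.prod (𝒢 n)] (fun p : E × Ω => ξ n p.1 p.2)) ∧
    iIndep 𝒢 Pr ∧
    Indep (⨆ n, 𝒢 n) (⨆ n : ℕ+, mE.comap (X n)) Pr

/-- `S_n = ξ_1^{X_1} + ⋯ + ξ_n^{X_n}`, with `S_0 = 0`. -/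
def walk (X : ℕ → Ω → E) (ξ : ℕ → E → Ω → ℝ) (n : ℕ) (ω : Ω) : ℝ :=
  ∑ i ∈ Finset.Icc 1 n, ξ i (X i ω) ω

/-- `M = sup_{n ≥ 0} S_n`, possibly `+∞`. -/
def walkSup (X : ℕ → Ω → E) (ξ : ℕ → E → Ω → ℝ) (ω : Ω) : EReal :=
  ⨆ n : ℕ, (walk X ξ n ω : EReal)

/-- `μ(y) = min {n ≥ 1 : S_n > y}`. For `y ≥ 0` the set is nonempty exactly if `M > y`; the value
is only used on that event. -/
def passageTime (X : ℕ → Ω → E) (ξ : ℕ → E → Ω → ℝ) (y : ℝ) (ω : Ω) : ℕ :=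
  sInf {n : ℕ | 1 ≤ n ∧ y < walk X ξ n ω}

/-- The averages over `d` consecutive times of the laws of `X_n` converge to `π` in total
variation. -/
def ConvergesInMean (Pr : Measure Ω) (X : ℕ → Ω → E) (d : ℕ) (π : Measure E) : Prop :=
  Tendsto
    (fun n : ℕ => tvDist ((d : ℝ≥0∞)⁻¹ • ∑ j ∈ Finset.range d, Pr.map (X (n + j))) π)
    atTop (𝓝 0)

/-- `S_n / n → -a` almost surely. -/
def HasDrift (Pr : Measure Ω) (X : ℕ → Ω → E) (ξ : ℕ → E → Ω → ℝ) (a : ℝ) : Prop :=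
  ∀ᵐ ω ∂Pr, Tendsto (fun n : ℕ => walk X ξ n ω / n) atTop (𝓝 (-a))

end Walk

end ModulatedWalk

end

namespace ModulatedWalk

/-! ### Subexponential laws on the half-line -/

section Subexp

variable {Q : Measure ℝ}

/-! The principle is that of a single big jump: the walk drifts along the line `-a n`, and exceeds a
high level `y` essentially only when one increment `ξ_n` is larger than `y + a n`. Summing these
probabilities over `n` with `X_n ∈ B` gives about `∑ C(B) F̄(y + a n)`, a Riemann sum for `(C(B)/a)
∫_y^∞ F̄`. Condition (C1) controls only averages over `d` consecutive times, which is enough because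
`F̄` is monotone and its integrated tail is insensitive to bounded shifts (`eventually_jumpSum_le`,
`eventually_le_jumpSum`).

Lower bound, for every `B` (`IsHistory.eventually_le_measure`): for `β > a` the past up to time `n`
is typical, meaning that the walk has stayed below `K` and lies above `-K - β n`, with probability
at least `1 - δ` uniformly in `n`. A jump above `y + K + β (n + 1)` after a typical past makes `n +
1` the passage time. These events are disjoint in `n`, so their probabilities add up; then `β ↓ a`.

Upper bound, only for the whole event `M > y` (`IsHistory.eventually_measure_exceed_le`): for `α <
a` the barrier `K - α n` is ever crossed with probability at most `δ`. At the first crossing the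
walk is either already near or above `y`, which requires a big jump, or it has a long way still to
climb. The remaining climb is dominated by a walk with independent steps of law `G`, which exceeds
`y` with probability at most `R F̄^s(y)`. Subexponentiality bounds the convolution of the crossing
law, of mass at most `δ`, with this tail by a small multiple of `F̄^s(y)`.

The bound `R F̄^s` for the dominating walk (`IsIntegratedLaw.exists_exceedProb_le`) comes from the
same decomposition applied to that walk itself: it bounds the ratio to `F̄^s` by a constant plus
half its own supremum.

The lower bounds for `B` and `Bᶜ` add up to the upper bound for the total, so all of them are sharp;
no separate upper bound for `B` is needed. -/

theorem ae_prod_nonneg [SFinite Q] (hQ : Q (Iio 0) = 0) : ∀ᵐ p ∂(Q.prod Q), 0 ≤ p.1 ∧ 0 ≤ p.2 := by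
  have h : ∀ᵐ x ∂Q, 0 ≤ x := by
    rw [ae_iff]
    simpa [Iio] using hQ
  exact (Measure.quasiMeasurePreserving_fst.ae h).and (Measure.quasiMeasurePreserving_snd.ae h)

theorem tail_conv (y : ℝ) : tail (Q.conv Q) y = (Q.prod Q).real {p | y < p.1 + p.2} := by
  rw [tail, Measure.conv, measureReal_def, Measure.map_apply (by fun_prop) measurableSet_Ioi]
  rfl

variable [IsProbabilityMeasure Q]

theorem measureReal_Iic_eq (h : ℝ) : Q.real (Iic h) = 1 - Q.real (Ioi h) := by
  rw [← compl_Ioi, probReal_compl_eq_one_sub measurableSet_Ioi]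

/-- The three terms are the masses of disjoint rectangles on which the sum exceeds `y`. The last one
carries the shifted tail, which is how the ratio condition yields long-tailedness. -/
theorem tail_conv_ge_of_one_small (hQ : Q (Iio 0) = 0) {h y : ℝ} (hy : h ≤ y) :
    Q.real (Ioi y) + (1 - Q.real (Ioi h)) * Q.real (Ioi y)
      + (Q.real (Ioi h) - Q.real (Ioi y)) * Q.real (Ioi (y - h)) ≤ tail (Q.conv Q) y := by
  have e1 : (Q.prod Q).real (Ioi y ×ˢ univ) = Q.real (Ioi y) := by
    simp [measureReal_prod_prod]
  have e2 : (Q.prod Q).real (Iic h ×ˢ Ioi y) = (1 - Q.real (Ioi h)) * Q.real (Ioi y) := by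
    rw [measureReal_prod_prod, measureReal_Iic_eq]
  have e3 : (Q.prod Q).real (Ioc h y ×ˢ Ioi (y - h))
      = (Q.real (Ioi h) - Q.real (Ioi y)) * Q.real (Ioi (y - h)) := by
    rw [measureReal_prod_prod, ← Ioi_sdiff_Ioi, measureReal_sdiff (Ioi_subset_Ioi hy)
      measurableSet_Ioi]
  have d1 : Disjoint (Ioi y ×ˢ (univ : Set ℝ)) (Iic h ×ˢ Ioi y) := by
    rw [Set.disjoint_left]
    rintro ⟨a, b⟩ ⟨h1, -⟩ ⟨h2, -⟩
    simp only [mem_Ioi, mem_Iic] at h1 h2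
    linarith
  have d2 : Disjoint (Ioi y ×ˢ (univ : Set ℝ) ∪ Iic h ×ˢ Ioi y) (Ioc h y ×ˢ Ioi (y - h)) := by
    rw [Set.disjoint_left]
    rintro ⟨a, b⟩ (⟨h1, -⟩ | ⟨h1, -⟩) ⟨h2, -⟩ <;>
      simp only [mem_Ioi, mem_Iic, mem_Ioc] at h1 h2 <;> linarith
  rw [tail_conv, ← e3, ← e2]
  nth_rewrite 1 [← e1]
  rw [← measureReal_union d1 (measurableSet_Iic.prod measurableSet_Ioi),
    ← measureReal_union d2 (measurableSet_Ioc.prod measurableSet_Ioi)]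
  refine ENNReal.toReal_mono (measure_ne_top _ _) (measure_mono_ae ?_)
  filter_upwards [ae_prod_nonneg hQ] with p hp hmem
  change y < p.1 + p.2
  rcases hmem with (⟨h1, -⟩ | ⟨-, h2⟩) | ⟨h1, h2⟩
  · have : y < p.1 := h1
    linarith [hp.2]
  · have : y < p.2 := h2
    linarith [hp.1]
  · have : h < p.1 := h1.1
    have : y - h < p.2 := h2
    linarith

/-- When one summand is at most `h` and the other exceeds `y`, the sum exceeds `y`. For large `h`
these two rectangles already use up almost the whole limit `2`, leaving little for the event that
both summands are large. -/
theorem tail_conv_ge_of_both_large (hQ : Q (Iio 0) = 0) {h y : ℝ} (hy : h ≤ y) :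
    2 * ((1 - Q.real (Ioi h)) * Q.real (Ioi y))
      + (Q.prod Q).real {p | h < p.1 ∧ h < p.2 ∧ y < p.1 + p.2} ≤ tail (Q.conv Q) y := by
  have e1 : (Q.prod Q).real (Iic h ×ˢ Ioi y) = (1 - Q.real (Ioi h)) * Q.real (Ioi y) := by
    rw [measureReal_prod_prod, measureReal_Iic_eq]
  have e2 : (Q.prod Q).real (Ioi y ×ˢ Iic h) = (1 - Q.real (Ioi h)) * Q.real (Ioi y) := by
    rw [measureReal_prod_prod, measureReal_Iic_eq, mul_comm]
  have d1 : Disjoint (Iic h ×ˢ Ioi y) (Ioi y ×ˢ Iic h) := by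
    rw [Set.disjoint_left]
    rintro ⟨a, b⟩ ⟨h1, -⟩ ⟨h2, -⟩
    simp only [mem_Ioi, mem_Iic] at h1 h2
    linarith
  have d2 : Disjoint (Iic h ×ˢ Ioi y ∪ Ioi y ×ˢ Iic h)
      {p : ℝ × ℝ | h < p.1 ∧ h < p.2 ∧ y < p.1 + p.2} := by
    rw [Set.disjoint_left]
    rintro ⟨a, b⟩ (⟨h1, -⟩ | ⟨-, h1⟩) ⟨h2, h3, -⟩ <;>
      simp only [mem_Iic] at h1 h2 h3 <;> linarith
  have m : MeasurableSet {p : ℝ × ℝ | h < p.1 ∧ h < p.2 ∧ y < p.1 + p.2} := by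
    exact (measurableSet_lt measurable_const measurable_fst).inter
      ((measurableSet_lt measurable_const measurable_snd).inter
        (measurableSet_lt measurable_const (measurable_fst.add measurable_snd)))
  rw [two_mul]
  nth_rewrite 1 [← e1]
  rw [tail_conv, ← e2, ← measureReal_union d1 (measurableSet_Ioi.prod measurableSet_Iic),
    ← measureReal_union d2 m]
  refine ENNReal.toReal_mono (measure_ne_top _ _) (measure_mono_ae ?_)
  filter_upwards [ae_prod_nonneg hQ] with p hp hmem
  change y < p.1 + p.2
  rcases hmem with (⟨-, h2⟩ | ⟨h1, -⟩) | ⟨-, -, h2⟩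
  · have : y < p.2 := h2
    linarith [hp.1]
  · have : y < p.1 := h1
    linarith [hp.2]
  · exact h2

theorem tendsto_measureReal_Ioi_atTop : Tendsto (fun y => Q.real (Ioi y)) atTop (𝓝 0) := by
  have h : Tendsto (fun y => Q (Ioi y)) atTop (𝓝 (Q (⋂ y, Ioi y))) :=
    tendsto_measure_iInter_atTop (fun i => measurableSet_Ioi.nullMeasurableSet)
      (fun i j hij => Ioi_subset_Ioi hij) ⟨0, measure_ne_top _ _⟩
  have he : (⋂ y : ℝ, Ioi y) = ∅ := by
    ext z
    simp only [mem_iInter, mem_Ioi, mem_empty_iff_false, iff_false, not_forall, not_lt]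
    exact ⟨z, le_rfl⟩
  rw [he, measure_empty] at h
  exact (ENNReal.tendsto_toReal ENNReal.zero_ne_top).comp h

/-- A subexponential law on the half-line is long-tailed. -/
theorem longTailed_of_subexponential (hQ : Q (Iio 0) = 0) (hpos : ∀ y, 0 < Q.real (Ioi y))
    (h2 : Tendsto (fun y => tail (Q.conv Q) y / Q.real (Ioi y)) atTop (𝓝 2)) {h : ℝ} (hh : 0 ≤ h) :
    Tendsto (fun y => Q.real (Ioi (y - h)) / Q.real (Ioi y)) atTop (𝓝 1) := by
  have hq := hpos h
  -- This is the upper bound for the ratio obtained by solving `tail_conv_ge_of_one_small` for the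
  -- shifted tail.
  have hlim : Tendsto (fun y => (tail (Q.conv Q) y / Q.real (Ioi y) - 2 + Q.real (Ioi h)) /
      (Q.real (Ioi h) - Q.real (Ioi y))) atTop
      (𝓝 ((2 - 2 + Q.real (Ioi h)) / (Q.real (Ioi h) - 0))) :=
    ((h2.sub_const 2).add_const _).div (tendsto_const_nhds.sub tendsto_measureReal_Ioi_atTop)
      (by simpa using hq.ne')
  have e : (2 - 2 + Q.real (Ioi h)) / (Q.real (Ioi h) - 0) = 1 := by
    rw [sub_self, zero_add, sub_zero, div_self hq.ne']
  rw [e] at hlim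
  refine tendsto_of_tendsto_of_tendsto_of_le_of_le' tendsto_const_nhds hlim ?_ ?_
  · refine Eventually.of_forall fun y => ?_
    rw [one_le_div (hpos y)]
    exact measureReal_mono (Ioi_subset_Ioi (by linarith))
  · filter_upwards [eventually_ge_atTop h,
      (tendsto_measureReal_Ioi_atTop (Q := Q)).eventually (gt_mem_nhds hq)] with y hy hlt
    have hb := tail_conv_ge_of_one_small hQ hy
    have hp := hpos y
    rw [le_div_iff₀ (sub_pos.2 hlt), div_mul_eq_mul_div, div_le_iff₀ hp]
    have : tail (Q.conv Q) y / Q.real (Ioi y) * Q.real (Ioi y) = tail (Q.conv Q) y :=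
      div_mul_cancel₀ _ hp.ne'
    nlinarith

theorem measure_le_ofReal_mul_of_div_le {μ ν : Measure ℝ} [IsFiniteMeasure μ] {s t : Set ℝ}
    [IsFiniteMeasure ν] {r : ℝ} (hr : 0 ≤ r) (h : μ.real s ≤ r * ν.real t) :
    μ s ≤ ENNReal.ofReal r * ν t := by
  rw [← ofReal_measureReal (μ := μ), ← ofReal_measureReal (μ := ν), ← ENNReal.ofReal_mul hr]
  exact ENNReal.ofReal_le_ofReal h

theorem eventually_measure_Ioi_sub_le (hQ : Q (Iio 0) = 0) (hpos : ∀ y, 0 < Q.real (Ioi y))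
    (h2 : Tendsto (fun y => tail (Q.conv Q) y / Q.real (Ioi y)) atTop (𝓝 2)) (h : ℝ) {r : ℝ}
    (hr : 1 < r) : ∀ᶠ y in atTop, Q (Ioi (y - h)) ≤ ENNReal.ofReal r * Q (Ioi y) := by
  have hl := longTailed_of_subexponential hQ hpos h2 (le_max_right h 0)
  filter_upwards [hl.eventually (gt_mem_nhds hr)] with y hy
  refine measure_le_ofReal_mul_of_div_le (by linarith) ?_
  rw [div_lt_iff₀ (hpos y)] at hy
  refine le_trans (measureReal_mono (Ioi_subset_Ioi ?_)) hy.le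
  linarith [le_max_left h 0]

/-- For a subexponential law, the sum of two independent copies is large because of one of them. -/
theorem eventually_prod_both_large_le (hQ : Q (Iio 0) = 0) (hpos : ∀ y, 0 < Q.real (Ioi y))
    (h2 : Tendsto (fun y => tail (Q.conv Q) y / Q.real (Ioi y)) atTop (𝓝 2)) {ε : ℝ}
    (hε : 0 < ε) : ∀ᶠ h in atTop, ∀ᶠ y in atTop,
      (Q.prod Q) {p | h < p.1 ∧ h < p.2 ∧ y < p.1 + p.2} ≤ ENNReal.ofReal ε * Q (Ioi y) := by
  -- With `Q(Ioi h) < ε/4` the two rectangles contribute at least `2 - ε/2` relative to the tail,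
  -- while the convolution contributes less than `2 + ε/2`.
  filter_upwards [(tendsto_measureReal_Ioi_atTop (Q := Q)).eventually
    (gt_mem_nhds (show (0 : ℝ) < ε / 4 by linarith))] with h hh
  filter_upwards [eventually_ge_atTop h,
    h2.eventually (gt_mem_nhds (show (2 : ℝ) < 2 + ε / 2 by linarith))] with y hy hlt
  rw [← ofReal_measureReal (μ := Q.prod Q), ← ofReal_measureReal (μ := Q),
    ← ENNReal.ofReal_mul hε.le]
  refine ENNReal.ofReal_le_ofReal ?_
  have hb := tail_conv_ge_of_both_large hQ hy
  have hp := hpos y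
  rw [div_lt_iff₀ hp] at hlt
  nlinarith

end Subexp

/-! ### The integrated tail -/

/-- The integrated tail `∫_y^∞ H̄(t) dt`. -/
noncomputable def intTail (H : Measure ℝ) (y : ℝ) : ℝ≥0∞ := ∫⁻ t in Ioi y, H (Ioi t)

theorem measurable_measure_Ioi (H : Measure ℝ) : Measurable fun t => H (Ioi t) :=
  Antitone.measurable fun _ _ h => measure_mono (Ioi_subset_Ioi h)

theorem intTail_antitone (H : Measure ℝ) : Antitone (intTail H) := fun _ _ h =>
  lintegral_mono_set (Ioi_subset_Ioi h)

theorem intTail_ne_top {F : Measure ℝ} [IsProbabilityMeasure F]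
    (hF : Integrable (fun t : ℝ => t) F) (y : ℝ) : intTail F y ≠ ∞ := by
  have h0 : intTail F 0 ≠ ∞ := by
    have h := lintegral_eq_lintegral_meas_lt F (f := fun t => max t 0)
      (Eventually.of_forall fun t => le_max_right _ _) (by fun_prop)
    have : intTail F 0 = ∫⁻ t in Ioi 0, F {a | t < max a 0} := by
      refine setLIntegral_congr_fun measurableSet_Ioi fun t ht => ?_
      congr 1
      ext a
      have : (0 : ℝ) < t := ht
      simp [not_lt.2 this.le]
    rw [this, ← h]
    exact (Integrable.pos_part hF).lintegral_lt_top.ne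
  rcases le_or_gt 0 y with hy | hy
  · exact ((intTail_antitone F hy).trans_lt h0.lt_top).ne
  · rw [intTail, ← Ioc_union_Ioi_eq_Ioi hy.le]
    refine ((lintegral_union_le _ _ _).trans_lt (ENNReal.add_lt_top.2 ⟨?_, h0.lt_top⟩)).ne
    calc ∫⁻ t in Ioc y 0, F (Ioi t) ≤ ∫⁻ t in Ioc y 0, 1 := lintegral_mono fun t => prob_le_one
      _ < ∞ := by simp

theorem tendsto_intTail {F : Measure ℝ} [IsProbabilityMeasure F]
    (hF : Integrable (fun t : ℝ => t) F) : Tendsto (intTail F) atTop (𝓝 0) := by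
  set ν : Measure ℝ := volume.withDensity (fun t => F (Ioi t)) with hν
  have hφ : ∀ y, intTail F y = ν (Ioi y) := fun y => (withDensity_apply _ measurableSet_Ioi).symm
  have h : Tendsto (fun y => ν (Ioi y)) atTop (𝓝 (ν (⋂ y, Ioi y))) :=
    tendsto_measure_iInter_atTop (fun i => measurableSet_Ioi.nullMeasurableSet)
      (fun i j hij => Ioi_subset_Ioi hij) ⟨0, by rw [← hφ]; exact intTail_ne_top hF 0⟩
  have he : (⋂ y : ℝ, Ioi y) = ∅ := by
    ext z
    simp only [mem_iInter, mem_Ioi, mem_empty_iff_false, iff_false, not_forall, not_lt]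
    exact ⟨z, le_rfl⟩
  rw [he, measure_empty] at h
  exact (funext hφ : intTail F = _) ▸ h

theorem secondTail_eq (F : Measure ℝ) (y : ℝ) :
    secondTail F y = (min 1 (intTail F y)).toReal := rfl

section SecondTail

variable {F : Measure ℝ} [IsProbabilityMeasure F]

theorem tendsto_secondTail (hF : Integrable (fun t : ℝ => t) F) :
    Tendsto (secondTail F) atTop (𝓝 0) := by
  have h : Tendsto (fun y => min 1 (intTail F y)) atTop (𝓝 (min 1 0)) :=
    tendsto_const_nhds.min (tendsto_intTail hF)
  rw [min_eq_right zero_le_one] at h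
  exact (ENNReal.tendsto_toReal ENNReal.zero_ne_top).comp h

theorem measure_Ioi_of_neg (hF0 : F (Iio 0) = 0) {t : ℝ} (ht : t < 0) : F (Ioi t) = 1 := by
  rw [← compl_Iic, prob_compl_eq_one_iff measurableSet_Iic]
  exact measure_mono_null (Iic_subset_Iio.2 ht) hF0

/-- As `F` lives on `[0, ∞)`, its tail equals `1` on `(-1, 0)`, so that interval alone brings the
integral up to the truncation level. -/
theorem secondTail_of_le (hF0 : F (Iio 0) = 0) {y : ℝ} (hy : y ≤ -1) : secondTail F y = 1 := by
  have h1 : 1 ≤ intTail F (-1) := by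
    calc (1 : ℝ≥0∞) = ∫⁻ t in Ioo (-1 : ℝ) 0, 1 := by simp
      _ = ∫⁻ t in Ioo (-1 : ℝ) 0, F (Ioi t) :=
        setLIntegral_congr_fun measurableSet_Ioo fun t ht => (measure_Ioi_of_neg hF0 ht.2).symm
      _ ≤ intTail F (-1) := lintegral_mono_set Ioo_subset_Ioi_self
  rw [secondTail_eq, min_eq_left (h1.trans (intTail_antitone F hy)), ENNReal.toReal_one]

theorem isProbabilityMeasure_secondTailDist (hF0 : F (Iio 0) = 0)
    (hF : Integrable (fun t : ℝ => t) F) : IsProbabilityMeasure (secondTailDist F) := by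
  refine (secondTailCDF F).isProbabilityMeasure ?_ ?_
  · refine tendsto_const_nhds.congr' ?_
    filter_upwards [eventually_le_atBot (-1)] with y hy
    change 0 = 1 - secondTail F y
    rw [secondTail_of_le hF0 hy, sub_self]
  · have := (tendsto_secondTail hF).const_sub 1
    rwa [sub_zero] at this

theorem secondTailDist_Ioi (hF : Integrable (fun t : ℝ => t) F) (y : ℝ) :
    secondTailDist F (Ioi y) = min 1 (intTail F y) := by
  have := (tendsto_secondTail hF).const_sub 1
  rw [sub_zero] at this
  rw [secondTailDist, (secondTailCDF F).measure_Ioi this]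
  change ENNReal.ofReal (1 - (1 - secondTail F y)) = _
  rw [sub_sub_cancel, secondTail_eq, ENNReal.ofReal_toReal (by simp)]

theorem positivePart_Ioi (H : Measure ℝ) {y : ℝ} (hy : 0 ≤ y) :
    positivePart H (Ioi y) = H (Ioi y) := by
  rw [positivePart, Measure.map_apply (by fun_prop) measurableSet_Ioi]
  congr 1
  ext t
  simp [not_lt.2 hy]

theorem positivePart_Iio (H : Measure ℝ) : positivePart H (Iio 0) = 0 := by
  rw [positivePart, Measure.map_apply (by fun_prop) measurableSet_Iio]
  convert measure_empty (μ := H)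
  ext t
  simp

/-- What is used of the subexponentiality of the integrated tail distribution: a law `Q` on
`[0, ∞)` with the integrated tail of `F`, that is long-tailed and for which sums of two
independent copies are large because of one of them. -/
structure IsIntegratedLaw (F Q : Measure ℝ) : Prop where
  isProb : IsProbabilityMeasure Q
  tail_eq : ∀ y, 0 ≤ y → Q (Ioi y) = min 1 (intTail F y)
  pos : ∀ y, 0 < Q (Ioi y)
  long : ∀ h r : ℝ, 1 < r → ∀ᶠ y in atTop, Q (Ioi (y - h)) ≤ ENNReal.ofReal r * Q (Ioi y)
  both_large : ∀ ε : ℝ, 0 < ε → ∀ᶠ h in atTop, ∀ᶠ y in atTop,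
    (Q.prod Q) {p | h < p.1 ∧ h < p.2 ∧ y < p.1 + p.2} ≤ ENNReal.ofReal ε * Q (Ioi y)

theorem isIntegratedLaw_of_subexponential (hF0 : F (Iio 0) = 0)
    (hF : Integrable (fun t : ℝ => t) F) (hsub : Subexponential (secondTailDist F)) :
    IsIntegratedLaw F (positivePart (secondTailDist F)) := by
  have := isProbabilityMeasure_secondTailDist hF0 hF
  have hprob : IsProbabilityMeasure (positivePart (secondTailDist F)) :=
    Measure.isProbabilityMeasure_map (by fun_prop)
  have hpos : ∀ y, 0 < (positivePart (secondTailDist F)).real (Ioi y) := by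
    intro y
    refine lt_of_lt_of_le ?_ (measureReal_mono (Ioi_subset_Ioi (le_max_left y 0)))
    rw [measureReal_def, positivePart_Ioi _ (le_max_right y 0)]
    exact hsub.1 _
  have h0 := positivePart_Iio (secondTailDist F)
  exact {
    isProb := hprob
    tail_eq := fun y hy => by rw [positivePart_Ioi _ hy, secondTailDist_Ioi hF]
    pos := fun y => (ENNReal.toReal_pos_iff.1 (hpos y)).1
    long := fun h r hr => eventually_measure_Ioi_sub_le h0 hpos hsub.2 h hr
    both_large := fun ε hε => eventually_prod_both_large_le h0 hpos hsub.2 hε }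

end SecondTail

/-! ### Sums of tails along arithmetic progressions -/

section TailSums

variable {F : Measure ℝ}

theorem intTail_eq_tsum (F : Measure ℝ) {α : ℝ} (hα : 0 < α) (w : ℝ) :
    intTail F w = ∑' n : ℕ, ∫⁻ t in Ioc (w + α * n) (w + α * (n + 1)), F (Ioi t) := by
  set f : ℕ → ℝ := fun n => w + α * n with hf
  have hmono : Monotone f := by
    intro m n h
    have : (m : ℝ) ≤ n := by exact_mod_cast h
    simp only [hf]
    gcongr
  have hsucc : ∀ n : ℕ, f (Order.succ n) = w + α * (n + 1) := by
    intro n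
    simp [hf]
  have hunb : ¬ BddAbove (range f) := by
    rintro ⟨b, hb⟩
    obtain ⟨n, hn⟩ := exists_nat_gt ((b - w) / α)
    have := hb ⟨n, rfl⟩
    rw [div_lt_iff₀ hα] at hn
    simp only [hf] at this
    linarith
  have hU : (⋃ n : ℕ, Ioc (f n) (f (Order.succ n))) = Ioi w := by
    rw [iUnion_Ioc_map_succ_eq_Ioi (fun a => hmono bot_le) hunb]
    simp [hf]
  rw [intTail, ← hU, lintegral_iUnion (fun n => measurableSet_Ioc)
    hmono.pairwise_disjoint_on_Ioc_succ]
  exact tsum_congr fun n => by rw [hsucc]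

/-- Right-endpoint Riemann sum of a decreasing function; `intTail_le_tsum` is its left-endpoint
counterpart. -/
theorem tsum_measure_Ioi_le (F : Measure ℝ) {α : ℝ} (hα : 0 < α) (w : ℝ) :
    ENNReal.ofReal α * ∑' n : ℕ, F (Ioi (w + α * (n + 1))) ≤ intTail F w := by
  rw [intTail_eq_tsum F hα, ← ENNReal.tsum_mul_left]
  refine ENNReal.tsum_le_tsum fun n => ?_
  calc ENNReal.ofReal α * F (Ioi (w + α * (n + 1)))
      = ∫⁻ t in Ioc (w + α * n) (w + α * (n + 1)), F (Ioi (w + α * (n + 1))) := by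
        rw [setLIntegral_const, Real.volume_Ioc, mul_comm]
        congr 2
        ring
    _ ≤ _ := setLIntegral_mono (measurable_measure_Ioi F) fun t ht =>
        measure_mono (Ioi_subset_Ioi ht.2)

theorem intTail_le_tsum (F : Measure ℝ) {α : ℝ} (hα : 0 < α) (w : ℝ) :
    intTail F w ≤ ENNReal.ofReal α * ∑' n : ℕ, F (Ioi (w + α * n)) := by
  rw [intTail_eq_tsum F hα, ← ENNReal.tsum_mul_left]
  refine ENNReal.tsum_le_tsum fun n => ?_
  calc _ ≤ ∫⁻ t in Ioc (w + α * n) (w + α * (n + 1)), F (Ioi (w + α * n)) :=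
        setLIntegral_mono measurable_const fun t ht => measure_mono (Ioi_subset_Ioi ht.1.le)
    _ = ENNReal.ofReal α * F (Ioi (w + α * n)) := by
        rw [setLIntegral_const, Real.volume_Ioc, mul_comm]
        congr 2
        ring

theorem measure_Ioi_add_intTail_le (F : Measure ℝ) (y : ℝ) :
    F (Ioi y) + intTail F y ≤ intTail F (y - 1) := by
  have h : Ioc (y - 1) y ∪ Ioi y = Ioi (y - 1) := Ioc_union_Ioi_eq_Ioi (by linarith)
  rw [intTail, intTail, ← h, lintegral_union measurableSet_Ioi]
  · gcongr
    calc F (Ioi y) = ∫⁻ t in Ioc (y - 1) y, F (Ioi y) := by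
          rw [setLIntegral_const, Real.volume_Ioc]
          simp
      _ ≤ _ := setLIntegral_mono (measurable_measure_Ioi F) fun t ht =>
          measure_mono (Ioi_subset_Ioi ht.2)
  · exact Set.disjoint_left.2 fun t h1 h2 => not_lt.2 h1.2 h2

variable {Q : Measure ℝ}

theorem IsIntegratedLaw.measure_Ioi_pos (hQ : IsIntegratedLaw F Q) (z : ℝ) : 0 < F (Ioi z) := by
  by_contra hz
  have hz : F (Ioi z) = 0 := by simpa using hz
  have h1 : intTail F (max z 0) = 0 := by
    rw [intTail, ← lintegral_zero (μ := volume.restrict (Ioi (max z 0)))]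
    refine setLIntegral_congr_fun measurableSet_Ioi fun t ht => ?_
    exact measure_mono_null (Ioi_subset_Ioi ((le_max_left z 0).trans (le_of_lt ht))) hz
  have h2 := hQ.pos (max z 0)
  rw [hQ.tail_eq _ (le_max_right z 0), h1] at h2
  simp at h2

variable [IsProbabilityMeasure F]

theorem IsIntegratedLaw.eventually_eq (hQ : IsIntegratedLaw F Q)
    (hF : Integrable (fun t : ℝ => t) F) : ∀ᶠ y in atTop, Q (Ioi y) = intTail F y := by
  filter_upwards [eventually_ge_atTop 0,
    (tendsto_intTail hF).eventually (gt_mem_nhds zero_lt_one)] with y hy h1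
  rw [hQ.tail_eq y hy, min_eq_right h1.le]

theorem IsIntegratedLaw.intTail_long (hQ : IsIntegratedLaw F Q)
    (hF : Integrable (fun t : ℝ => t) F) (h : ℝ) {r : ℝ} (hr : 1 < r) :
    ∀ᶠ y in atTop, intTail F (y - h) ≤ ENNReal.ofReal r * intTail F y := by
  filter_upwards [hQ.long h r hr, hQ.eventually_eq hF,
    (tendsto_atTop_add_const_right atTop (-h) tendsto_id).eventually (hQ.eventually_eq hF)]
    with y h1 h2 h3
  rw [id, ← sub_eq_add_neg] at h3
  rwa [h2, h3] at h1

/-- The tail at `y` is at most the increment of the integrated tail over `[y - 1, y]`, which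
long-tailedness makes negligible. Hence finitely many early jumps do not matter. -/
theorem IsIntegratedLaw.measure_Ioi_isLittleO (hQ : IsIntegratedLaw F Q)
    (hF : Integrable (fun t : ℝ => t) F) {ε : ℝ} (hε : 0 < ε) :
    ∀ᶠ y in atTop, F (Ioi y) ≤ ENNReal.ofReal ε * intTail F y := by
  filter_upwards [hQ.intTail_long hF 1 (show 1 < 1 + ε by linarith)] with y hy
  have h := (measure_Ioi_add_intTail_le F y).trans hy
  rw [ENNReal.ofReal_add zero_le_one hε.le, ENNReal.ofReal_one, add_mul, one_mul, add_comm] at h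
  exact (ENNReal.add_le_add_iff_left (intTail_ne_top hF y)).1 h

end TailSums

/-! ### Total variation and the expected number of big jumps -/

section TotalVariation

variable {E : Type*} [MeasurableSpace E]

/-- By the layer-cake formula the error `δ` is incurred only at levels in `(0, M]`. Its
proportionality to the bound `M` is essential: the test functions used later are bounded by `L
F̄(z)`, so the error stays comparable to `F̄(z)`. -/
theorem lintegral_le_add_of_measure_le {μ ν : Measure E} {δ : ℝ≥0∞}
    (h : ∀ B, MeasurableSet B → μ B ≤ ν B + δ) {f : E → ℝ} (hf : Measurable f)
    (h0 : ∀ x, 0 ≤ f x) {M : ℝ} (hM : ∀ x, f x ≤ M) :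
    ∫⁻ x, ENNReal.ofReal (f x) ∂μ ≤ ∫⁻ x, ENNReal.ofReal (f x) ∂ν + δ * ENNReal.ofReal M := by
  rw [lintegral_eq_lintegral_meas_lt μ (Eventually.of_forall h0) hf.aemeasurable,
    lintegral_eq_lintegral_meas_lt ν (Eventually.of_forall h0) hf.aemeasurable]
  have hmono : Antitone fun t => ν {a | t < f a} :=
    fun s t hst => measure_mono fun a ha => lt_of_le_of_lt hst ha
  calc ∫⁻ t in Ioi 0, μ {a | t < f a}
      ≤ ∫⁻ t in Ioi 0, (ν {a | t < f a} + (Ioc 0 M).indicator (fun _ => δ) t) := by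
        refine setLIntegral_mono (hmono.measurable.add
          (measurable_const.indicator measurableSet_Ioc)) fun t ht => ?_
        by_cases htM : t ≤ M
        · rw [indicator_of_mem (show t ∈ Ioc 0 M from ⟨ht, htM⟩)]
          exact h _ (measurableSet_lt measurable_const hf)
        · have : {a | t < f a} = ∅ := by
            ext a
            simpa using (hM a).trans (not_le.1 htM).le
          simp [this]
    _ = _ := by
        rw [lintegral_add_left hmono.measurable, lintegral_indicator measurableSet_Ioc,
          Measure.restrict_restrict measurableSet_Ioc, setLIntegral_const,
          inter_eq_left.2 Ioc_subset_Ioi_self, Real.volume_Ioc, sub_zero]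

theorem bddAbove_tvDist (μ ν : Measure E) [IsFiniteMeasure μ] [IsFiniteMeasure ν] :
    BddAbove (range fun B : {B : Set E // MeasurableSet B} => |μ.real B - ν.real B|) := by
  refine ⟨μ.real univ + ν.real univ, ?_⟩
  rintro _ ⟨B, rfl⟩
  have h1 : μ.real (B : Set E) ≤ μ.real univ := measureReal_mono (subset_univ _)
  have h2 : ν.real (B : Set E) ≤ ν.real univ := measureReal_mono (subset_univ _)
  have h3 : 0 ≤ μ.real (B : Set E) := measureReal_nonneg
  have h4 : 0 ≤ ν.real (B : Set E) := measureReal_nonneg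
  exact abs_le.2 ⟨by linarith, by linarith⟩

theorem measure_le_add_tvDist (μ ν : Measure E) [IsFiniteMeasure μ] [IsFiniteMeasure ν] {δ : ℝ}
    (hδ : tvDist μ ν ≤ δ) {B : Set E} (hB : MeasurableSet B) :
    μ B ≤ ν B + ENNReal.ofReal δ ∧ ν B ≤ μ B + ENNReal.ofReal δ := by
  have h : |μ.real B - ν.real B| ≤ δ :=
    (le_ciSup (bddAbove_tvDist μ ν) ⟨B, hB⟩).trans hδ
  have hδ0 : 0 ≤ δ := (abs_nonneg _).trans h
  have h' := abs_le.1 h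
  rw [← ofReal_measureReal (μ := μ), ← ofReal_measureReal (μ := ν),
    ← ENNReal.ofReal_add measureReal_nonneg hδ0, ← ENNReal.ofReal_add measureReal_nonneg hδ0]
  exact ⟨ENNReal.ofReal_le_ofReal (by linarith), ENNReal.ofReal_le_ofReal (by linarith)⟩

end TotalVariation

section JumpSum

variable {E Ω : Type*} [MeasurableSpace E] [MeasurableSpace Ω]

/-- `P(X_n ∈ B, ξ_n > z)` for the modulated walk. -/
noncomputable def jumpProb (Pr : Measure Ω) (P : Kernel E ℝ) (X : ℕ → Ω → E) (B : Set E) (n : ℕ)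
    (z : ℝ) : ℝ≥0∞ :=
  ∫⁻ ω in X n ⁻¹' B, P (X n ω) (Ioi z) ∂Pr

/-- `∑_{n ≥ 1} P(X_n ∈ B, ξ_n > w + α n)`. -/
noncomputable def jumpSum (Pr : Measure Ω) (P : Kernel E ℝ) (X : ℕ → Ω → E) (B : Set E) (α w : ℝ) :
    ℝ≥0∞ :=
  ∑' n : ℕ, jumpProb Pr P X B (n + 1) (w + α * (n + 1))

variable {Pr : Measure Ω} {P : Kernel E ℝ} {X : ℕ → Ω → E} {B : Set E}

theorem jumpProb_antitone (n : ℕ) : Antitone (jumpProb Pr P X B n) := fun _ _ h =>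
  lintegral_mono fun _ => measure_mono (Ioi_subset_Ioi h)

theorem jumpProb_eq_map {n : ℕ} (hX : Measurable (X n)) (hB : MeasurableSet B) (z : ℝ) :
    jumpProb Pr P X B n z = ∫⁻ x in B, P x (Ioi z) ∂(Pr.map (X n)) := by
  rw [setLIntegral_map hB (Kernel.measurable_coe P measurableSet_Ioi) hX]
  rfl

variable [IsProbabilityMeasure Pr] {F : Measure ℝ} {L : ℝ}

theorem jumpProb_le (hL : ∀ x y, P x (Ioi y) ≤ ENNReal.ofReal L * F (Ioi y)) (n : ℕ) (z : ℝ) :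
    jumpProb Pr P X B n z ≤ ENNReal.ofReal L * F (Ioi z) := by
  calc jumpProb Pr P X B n z ≤ ∫⁻ ω, ENNReal.ofReal L * F (Ioi z) ∂Pr :=
        (setLIntegral_le_lintegral _ _).trans (lintegral_mono fun ω => hL _ _)
    _ = _ := by simp

theorem jumpSum_le_intTail (hL : ∀ x y, P x (Ioi y) ≤ ENNReal.ofReal L * F (Ioi y)) {α : ℝ}
    (hα : 0 < α) (w : ℝ) :
    jumpSum Pr P X B α w ≤ ENNReal.ofReal (L / α) * intTail F w := by
  calc jumpSum Pr P X B α w ≤ ∑' n : ℕ, ENNReal.ofReal L * F (Ioi (w + α * (n + 1))) :=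
        ENNReal.tsum_le_tsum fun n => jumpProb_le hL _ _
    _ = ENNReal.ofReal (L / α) * (ENNReal.ofReal α * ∑' n : ℕ, F (Ioi (w + α * (n + 1)))) := by
        rw [ENNReal.tsum_mul_left, ← mul_assoc, ← ENNReal.ofReal_mul' hα.le,
          div_mul_cancel₀ _ hα.ne']
    _ ≤ _ := by gcongr; exact tsum_measure_Ioi_le F hα w

theorem tail_div_nonneg (x : E) (z : ℝ) : 0 ≤ tail (P x) z / tail F z :=
  div_nonneg measureReal_nonneg measureReal_nonneg

theorem measurable_tail_div (z : ℝ) : Measurable fun x => tail (P x) z / tail F z :=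
  ((Kernel.measurable_coe P measurableSet_Ioi).ennreal_toReal).div_const _

variable [IsProbabilityMeasure F] {c : E → ℝ} {π : Measure E} [IsProbabilityMeasure π] {d : ℕ}

theorem tail_div_le (hL : ∀ x y, P x (Ioi y) ≤ ENNReal.ofReal L * F (Ioi y)) (hL0 : 0 ≤ L)
    (hFpos : ∀ z, 0 < F (Ioi z)) (x : E) (z : ℝ) : tail (P x) z / tail F z ≤ L := by
  have hpos : 0 < tail F z := ENNReal.toReal_pos (hFpos z).ne' (measure_ne_top _ _)
  rw [div_le_iff₀ hpos]
  have := ENNReal.toReal_mono (ENNReal.mul_ne_top ENNReal.ofReal_ne_top (measure_ne_top _ _))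
    (hL x z)
  rwa [ENNReal.toReal_mul, ENNReal.toReal_ofReal hL0] at this

theorem tendsto_tail_div (hFpos : ∀ z, 0 < F (Ioi z)) {x : E}
    (htail : (fun y => tail (P x) y - c x * tail F y) =o[atTop] tail F) :
    Tendsto (fun z => tail (P x) z / tail F z) atTop (𝓝 (c x)) := by
  have h := htail.tendsto_div_nhds_zero.add_const (c x)
  rw [zero_add] at h
  refine h.congr fun z => ?_
  have : tail F z ≠ 0 := (ENNReal.toReal_pos (hFpos z).ne' (measure_ne_top _ _)).ne'
  field_simp
  ring

/-- The tail equivalence is only pointwise in `x`; the uniform bound `L` on the ratios makes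
dominated convergence applicable. -/
theorem tendsto_integral_tail_div (hL : ∀ x y, P x (Ioi y) ≤ ENNReal.ofReal L * F (Ioi y))
    (hL0 : 0 ≤ L) (hFpos : ∀ z, 0 < F (Ioi z))
    (htail : ∀ x, (fun y => tail (P x) y - c x * tail F y) =o[atTop] tail F) :
    Tendsto (fun z => ∫ x in B, tail (P x) z / tail F z ∂π) atTop (𝓝 (∫ x in B, c x ∂π)) := by
  refine tendsto_integral_filter_of_dominated_convergence (fun _ => L) ?_ ?_ ?_ ?_
  · exact Eventually.of_forall fun z => (measurable_tail_div z).aestronglyMeasurable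
  · refine Eventually.of_forall fun z => Eventually.of_forall fun x => ?_
    rw [Real.norm_of_nonneg (tail_div_nonneg x z)]
    exact tail_div_le hL hL0 hFpos x z
  · exact integrable_const _
  · exact Eventually.of_forall fun x => tendsto_tail_div hFpos (htail x)

variable [IsMarkovKernel P]

theorem lintegral_eq_ofReal_mul (hFpos : ∀ z, 0 < F (Ioi z))
    (hL : ∀ x y, P x (Ioi y) ≤ ENNReal.ofReal L * F (Ioi y)) (hL0 : 0 ≤ L) (z : ℝ) :
    ∫⁻ x in B, P x (Ioi z) ∂π
      = ENNReal.ofReal (∫ x in B, tail (P x) z / tail F z ∂π) * F (Ioi z) := by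
  have hpos : 0 < tail F z := ENNReal.toReal_pos (hFpos z).ne' (measure_ne_top _ _)
  rw [ofReal_integral_eq_lintegral_ofReal,
    ← lintegral_mul_const _ (measurable_tail_div z).ennreal_ofReal]
  · refine lintegral_congr fun x => ?_
    rw [← ofReal_measureReal (μ := F), ← ENNReal.ofReal_mul (tail_div_nonneg x z)]
    change _ = ENNReal.ofReal (tail (P x) z / tail F z * tail F z)
    rw [div_mul_cancel₀ _ hpos.ne']
    exact (ofReal_measureReal).symm
  · exact Integrable.of_bound (measurable_tail_div z).aestronglyMeasurable L
      (Eventually.of_forall fun x => by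
        rw [Real.norm_of_nonneg (tail_div_nonneg x z)]
        exact tail_div_le hL hL0 hFpos x z)
  · exact Eventually.of_forall fun x => tail_div_nonneg x z

/-- Over `d` consecutive times, the probabilities of a big jump are those of the stationary law. -/
theorem eventually_sum_jumpProb (hX : ∀ n, 1 ≤ n → Measurable (X n)) (hB : MeasurableSet B)
    (hL : ∀ x y, P x (Ioi y) ≤ ENNReal.ofReal L * F (Ioi y)) (hL0 : 0 ≤ L)
    (hFpos : ∀ z, 0 < F (Ioi z))
    (htail : ∀ x, (fun y => tail (P x) y - c x * tail F y) =o[atTop] tail F)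
    (hd : 0 < d) (hC1 : ConvergesInMean Pr X d π) {δ : ℝ} (hδ : 0 < δ) :
    ∃ N : ℕ, ∃ z₀ : ℝ, ∀ n, N ≤ n → ∀ z, z₀ ≤ z →
      ∑ j ∈ Finset.range d, jumpProb Pr P X B (n + 1 + j) z
          ≤ d * ENNReal.ofReal ((∫ x in B, c x ∂π) + δ) * F (Ioi z) ∧
      d * ENNReal.ofReal ((∫ x in B, c x ∂π) - δ) * F (Ioi z)
          ≤ ∑ j ∈ Finset.range d, jumpProb Pr P X B (n + 1 + j) z := by
  set C := ∫ x in B, c x ∂π with hC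
  set δ' : ℝ := δ / (2 * (L + 1)) with hδ'
  have hδ'0 : 0 < δ' := by positivity
  obtain ⟨N, hN⟩ := eventually_atTop.1 (hC1.eventually (gt_mem_nhds hδ'0))
  have hlim := tendsto_integral_tail_div (B := B) (π := π) hL hL0 hFpos htail
  obtain ⟨z₁, hz₁⟩ := eventually_atTop.1 ((hlim.eventually
    (gt_mem_nhds (show C < C + δ / 2 by linarith))).and
    (hlim.eventually (lt_mem_nhds (show C - δ / 2 < C by linarith))))
  refine ⟨N, z₁, fun n hn z hz => ?_⟩
  have hd0 : (d : ℝ≥0∞) ≠ 0 := by exact_mod_cast hd.ne'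
  have hdt : (d : ℝ≥0∞) ≠ ∞ := ENNReal.natCast_ne_top d
  set ν : Measure E := (d : ℝ≥0∞)⁻¹ • ∑ j ∈ Finset.range d, Pr.map (X (n + 1 + j)) with hν
  have hνfin : IsFiniteMeasure ν := by
    refine ⟨?_⟩
    rw [hν, Measure.smul_apply, smul_eq_mul, Measure.finsetSum_apply]
    exact ENNReal.mul_lt_top (ENNReal.inv_lt_top.2 (by exact_mod_cast hd))
      (ENNReal.sum_lt_top.2 fun j _ => measure_lt_top _ _)
  have htv : tvDist ν π ≤ δ' := (hN (n + 1) (by lia)).le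
  have hsum : ∑ j ∈ Finset.range d, jumpProb Pr P X B (n + 1 + j) z
      = d * ∫⁻ x in B, P x (Ioi z) ∂ν := by
    rw [hν, Measure.restrict_smul, lintegral_smul_measure, smul_eq_mul, ← mul_assoc,
      ENNReal.mul_inv_cancel hd0 hdt, one_mul, ← lintegral_indicator hB,
      lintegral_finsetSum_measure]
    refine Finset.sum_congr rfl fun j _ => ?_
    rw [jumpProb_eq_map (hX _ (by lia)) hB, lintegral_indicator hB]
  have hind : ∀ μ : Measure E, ∫⁻ x in B, P x (Ioi z) ∂μ
      = ∫⁻ x, ENNReal.ofReal (B.indicator (fun x => (P x).real (Ioi z)) x) ∂μ := by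
    intro μ
    rw [← lintegral_indicator hB]
    refine lintegral_congr fun x => ?_
    by_cases hx : x ∈ B <;> simp [hx]
  have hmeas : Measurable (B.indicator (fun x => (P x).real (Ioi z))) :=
    (Kernel.measurable_coe P measurableSet_Ioi).ennreal_toReal.indicator hB
  have hnn : ∀ x, 0 ≤ B.indicator (fun x => (P x).real (Ioi z)) x := fun x =>
    indicator_nonneg (fun _ _ => measureReal_nonneg) x
  have hle : ∀ x, B.indicator (fun x => (P x).real (Ioi z)) x ≤ L * F.real (Ioi z) := by
    intro x
    refine (indicator_le_self' (fun _ _ => measureReal_nonneg) x).trans ?_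
    have := ENNReal.toReal_mono (ENNReal.mul_ne_top ENNReal.ofReal_ne_top (measure_ne_top _ _))
      (hL x z)
    rwa [ENNReal.toReal_mul, ENNReal.toReal_ofReal hL0] at this
  have hsmall : ENNReal.ofReal δ' * ENNReal.ofReal (L * F.real (Ioi z))
      ≤ ENNReal.ofReal (δ / 2) * F (Ioi z) := by
    rw [ENNReal.ofReal_mul hL0, ← mul_assoc, ← ENNReal.ofReal_mul hδ'0.le, ofReal_measureReal]
    gcongr
    rw [hδ', div_mul_eq_mul_div, div_le_div_iff₀ (by positivity) (by positivity)]
    nlinarith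
  have h1 := lintegral_le_add_of_measure_le
    (fun A hA => (measure_le_add_tvDist ν π htv hA).1) hmeas hnn hle
  have h2 := lintegral_le_add_of_measure_le
    (fun A hA => (measure_le_add_tvDist ν π htv hA).2) hmeas hnn hle
  rw [← hind, ← hind, lintegral_eq_ofReal_mul (π := π) hFpos hL hL0] at h1 h2
  have hz' := hz₁ z hz
  have hInn : 0 ≤ ∫ x in B, tail (P x) z / tail F z ∂π :=
    integral_nonneg fun x => div_nonneg measureReal_nonneg measureReal_nonneg
  have hF0 : F (Ioi z) ≠ ∞ := measure_ne_top _ _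
  rw [hsum]
  constructor
  · rw [mul_assoc]
    gcongr
    refine h1.trans ((add_le_add_right hsmall _).trans ?_)
    rw [← add_mul, ← ENNReal.ofReal_add hInn (by linarith)]
    gcongr ENNReal.ofReal ?_ * _
    linarith [hz'.1]
  · rw [mul_assoc]
    gcongr
    rcases le_or_gt (C - δ) 0 with hneg | hposC
    · rw [ENNReal.ofReal_of_nonpos hneg, zero_mul]
      exact zero_le
    have h3 := h2.trans (add_le_add_right hsmall _)
    have h4 : ENNReal.ofReal (C - δ) * F (Ioi z) + ENNReal.ofReal (δ / 2) * F (Ioi z)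
        ≤ ∫⁻ x in B, P x (Ioi z) ∂ν + ENNReal.ofReal (δ / 2) * F (Ioi z) := by
      refine le_trans ?_ h3
      rw [← add_mul, ← ENNReal.ofReal_add hposC.le (by linarith)]
      gcongr ENNReal.ofReal ?_ * _
      linarith [hz'.2]
    exact (ENNReal.add_le_add_iff_right
      (ENNReal.mul_ne_top ENNReal.ofReal_ne_top hF0)).1 h4

/-- Division with remainder by `d` groups the times after `N` into blocks of `d` consecutive ones,
the form in which (C1) can be used. -/
theorem jumpSum_eq (Pr : Measure Ω) (P : Kernel E ℝ) (X : ℕ → Ω → E) (B : Set E) (hd : 0 < d)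
    (N : ℕ) (α w : ℝ) :
    jumpSum Pr P X B α w
      = ∑ i ∈ Finset.range N, jumpProb Pr P X B (i + 1) (w + α * (i + 1))
        + ∑' k : ℕ, ∑ j ∈ Finset.range d, jumpProb Pr P X B (N + d * k + 1 + j)
          (w + α * (N + d * k + 1 + j)) := by
  have : NeZero d := ⟨hd.ne'⟩
  rw [jumpSum, ← Summable.sum_add_tsum_nat_add' (k := N) ENNReal.summable]
  congr 1
  rw [← (Nat.divModEquiv d).symm.tsum_eq, ENNReal.tsum_prod']
  refine tsum_congr fun k => ?_
  rw [tsum_fintype, Finset.sum_range]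
  refine Finset.sum_congr rfl fun j _ => ?_
  simp only [Nat.divModEquiv_symm_apply]
  congr 1
  · ring
  · push_cast
    ring

variable {Q : Measure ℝ} {α : ℝ}

/-- Within a block all thresholds are lowered to a common one, giving a Riemann sum of mesh `α d`
whose factor `d` cancels the block length. The first `N` terms are `O(F̄)`, hence negligible, and
all shifts are absorbed by long-tailedness. -/
theorem eventually_jumpSum_le (hQ : IsIntegratedLaw F Q) (hF : Integrable (fun t : ℝ => t) F)
    (hX : ∀ n, 1 ≤ n → Measurable (X n)) (hB : MeasurableSet B)
    (hL : ∀ x y, P x (Ioi y) ≤ ENNReal.ofReal L * F (Ioi y)) (hL0 : 0 ≤ L)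
    (htail : ∀ x, (fun y => tail (P x) y - c x * tail F y) =o[atTop] tail F)
    (hc : ∀ x, 0 ≤ c x) (hd : 0 < d) (hC1 : ConvergesInMean Pr X d π) (hα : 0 < α) (κ : ℝ) {ε : ℝ}
    (hε : 0 < ε) :
    ∀ᶠ y in atTop, jumpSum Pr P X B α (y - κ)
      ≤ ENNReal.ofReal ((∫ x in B, c x ∂π) / α + ε) * intTail F y := by
  set C := ∫ x in B, c x ∂π with hC
  have hC0 : 0 ≤ C := integral_nonneg fun x => hc x
  have hCα : 0 ≤ C / α := by positivity
  obtain ⟨N, z₀, hN⟩ := eventually_sum_jumpProb (π := π) hX hB hL hL0 hQ.measure_Ioi_pos htail hd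
    hC1 (show 0 < α * (ε / 4) by positivity)
  have hd' : (0 : ℝ) < d := by exact_mod_cast hd
  have hαd : 0 < α * d := by positivity
  have hpre : ∀ᶠ y in atTop, ENNReal.ofReal (N * L) * F (Ioi (y - κ))
      ≤ ENNReal.ofReal (ε / 4) * intTail F (y - κ) := by
    have h := hQ.measure_Ioi_isLittleO hF (show 0 < ε / 4 / (N * L + 1) by positivity)
    filter_upwards [(tendsto_atTop_add_const_right atTop (-κ) tendsto_id).eventually h] with y hy
    rw [id, ← sub_eq_add_neg] at hy
    calc ENNReal.ofReal (N * L) * F (Ioi (y - κ))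
        ≤ ENNReal.ofReal (N * L) * (ENNReal.ofReal (ε / 4 / (N * L + 1)) * intTail F (y - κ)) := by
          gcongr
      _ ≤ _ := by
          rw [← mul_assoc, ← ENNReal.ofReal_mul (by positivity)]
          gcongr
          rw [mul_div_assoc', div_le_iff₀ (by positivity)]
          nlinarith
  set r : ℝ := (C / α + ε) / (C / α + ε / 2) with hr
  have hr1 : 1 < r := by
    rw [hr, one_lt_div (by positivity)]
    linarith
  filter_upwards [hpre, hQ.intTail_long hF (κ + α * d) hr1, eventually_ge_atTop (z₀ + κ)]
    with y h1 h2 h3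
  set w := y - κ with hw
  have hnn : ∀ k j : ℕ, (0 : ℝ) ≤ α * (N + d * k + 1 + j) := fun k j => by positivity
  have hblock : ∑' k : ℕ, ∑ j ∈ Finset.range d, jumpProb Pr P X B (N + d * k + 1 + j)
      (w + α * (N + d * k + 1 + j))
      ≤ ENNReal.ofReal (C / α + ε / 4) * intTail F (w - α * d) := by
    -- The common threshold `w + α d k` is written as `w - α d + α d (k + 1)` to match the
    -- right-endpoint sum started at `w - α d`.
    calc _ ≤ ∑' k : ℕ, d * ENNReal.ofReal (C + α * (ε / 4))
            * F (Ioi (w - α * d + α * d * (k + 1))) := by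
          refine ENNReal.tsum_le_tsum fun k => ?_
          refine le_trans (Finset.sum_le_sum fun j _ => jumpProb_antitone _ ?_)
            (hN (N + d * k) (by lia) (w - α * d + α * d * (k + 1)) ?_).1
          · have : 0 ≤ α * (N + 1 + j : ℝ) := by positivity
            nlinarith
          · have : 0 ≤ α * d * (k : ℝ) := by positivity
            linarith
      _ = ENNReal.ofReal (C / α + ε / 4) * (ENNReal.ofReal (α * d)
            * ∑' k : ℕ, F (Ioi (w - α * d + α * d * (k + 1)))) := by
          rw [ENNReal.tsum_mul_left, ← mul_assoc (ENNReal.ofReal _),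
            ← ENNReal.ofReal_mul (by positivity), ← ENNReal.ofReal_natCast d,
            ← ENNReal.ofReal_mul hd'.le]
          congr 2
          field_simp
      _ ≤ _ := by gcongr; exact tsum_measure_Ioi_le F hαd _
  have hinit : ∑ i ∈ Finset.range N, jumpProb Pr P X B (i + 1) (w + α * (i + 1))
      ≤ ENNReal.ofReal (N * L) * F (Ioi w) := by
    calc _ ≤ ∑ i ∈ Finset.range N, ENNReal.ofReal L * F (Ioi w) := by
          refine Finset.sum_le_sum fun i _ => (jumpProb_le hL _ _).trans ?_
          gcongr
          have : 0 ≤ α * ((i : ℝ) + 1) := by positivity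
          linarith
      _ = _ := by
          rw [Finset.sum_const, Finset.card_range, nsmul_eq_mul, ENNReal.ofReal_mul (by positivity),
            ENNReal.ofReal_natCast, mul_assoc]
  rw [jumpSum_eq Pr P X B hd N]
  calc _ ≤ ENNReal.ofReal (ε / 4) * intTail F w
        + ENNReal.ofReal (C / α + ε / 4) * intTail F (w - α * d) :=
        add_le_add (hinit.trans h1) hblock
    _ ≤ ENNReal.ofReal (ε / 4) * intTail F (w - α * d)
        + ENNReal.ofReal (C / α + ε / 4) * intTail F (w - α * d) := by
        gcongr
        exact intTail_antitone F (by linarith)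
    _ = ENNReal.ofReal (C / α + ε / 2) * intTail F (y - (κ + α * d)) := by
        rw [← add_mul, ← ENNReal.ofReal_add (by positivity) (by positivity), hw, sub_sub]
        congr 2
        ring
    _ ≤ ENNReal.ofReal (C / α + ε / 2) * (ENNReal.ofReal r * intTail F y) := by gcongr
    _ = _ := by
        rw [← mul_assoc, ← ENNReal.ofReal_mul (by positivity), hr, mul_div_cancel₀]
        positivity

/-- Here the first `N` terms are simply discarded and the thresholds in each block are raised to a
common one. -/
theorem eventually_le_jumpSum (hQ : IsIntegratedLaw F Q) (hF : Integrable (fun t : ℝ => t) F)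
    (hX : ∀ n, 1 ≤ n → Measurable (X n)) (hB : MeasurableSet B)
    (hL : ∀ x y, P x (Ioi y) ≤ ENNReal.ofReal L * F (Ioi y)) (hL0 : 0 ≤ L)
    (htail : ∀ x, (fun y => tail (P x) y - c x * tail F y) =o[atTop] tail F)
    (hd : 0 < d) (hC1 : ConvergesInMean Pr X d π) (hα : 0 < α) (κ : ℝ) {ε : ℝ}
    (hε : 0 < ε) :
    ∀ᶠ y in atTop, ENNReal.ofReal ((∫ x in B, c x ∂π) / α - ε) * intTail F y
      ≤ jumpSum Pr P X B α (y + κ) := by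
  set C := ∫ x in B, c x ∂π with hC
  rcases le_or_gt (C / α - ε) 0 with hneg | hpos
  · refine Eventually.of_forall fun y => ?_
    rw [ENNReal.ofReal_of_nonpos hneg, zero_mul]
    exact zero_le
  obtain ⟨N, z₀, hN⟩ := eventually_sum_jumpProb (π := π) hX hB hL hL0 hQ.measure_Ioi_pos htail hd
    hC1 (show 0 < α * (ε / 2) by positivity)
  have hd' : (0 : ℝ) < d := by exact_mod_cast hd
  have hαd : 0 < α * d := by positivity
  set r : ℝ := (C / α - ε / 2) / (C / α - ε) with hr
  have hr1 : 1 < r := by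
    rw [hr, one_lt_div hpos]
    linarith
  -- Since `j < d`, every threshold in the `k`-th block is at most `y + h + α d k`.
  set h : ℝ := κ + α * (N + 1 + d) with hh
  have hlong := (tendsto_atTop_add_const_right atTop h tendsto_id).eventually
    (hQ.intTail_long hF h hr1)
  filter_upwards [hlong, eventually_ge_atTop (z₀ - κ)] with y h2 h3
  rw [id, add_sub_cancel_right] at h2
  rw [jumpSum_eq Pr P X B hd N]
  refine le_trans ?_ le_add_self
  calc ENNReal.ofReal (C / α - ε) * intTail F y
      ≤ ENNReal.ofReal (C / α - ε) * (ENNReal.ofReal r * intTail F (y + h)) := by gcongr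
    _ = ENNReal.ofReal (C / α - ε / 2) * intTail F (y + h) := by
        rw [← mul_assoc, ← ENNReal.ofReal_mul hpos.le, hr, mul_div_cancel₀ _ hpos.ne']
    _ ≤ ENNReal.ofReal (C / α - ε / 2) * (ENNReal.ofReal (α * d)
          * ∑' k : ℕ, F (Ioi (y + h + α * d * k))) := by
        gcongr
        exact intTail_le_tsum F hαd _
    _ = ∑' k : ℕ, d * ENNReal.ofReal (C - α * (ε / 2)) * F (Ioi (y + h + α * d * k)) := by
        rw [ENNReal.tsum_mul_left, ← mul_assoc (ENNReal.ofReal _),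
          ← ENNReal.ofReal_mul (by linarith), ← ENNReal.ofReal_natCast d,
          ← ENNReal.ofReal_mul hd'.le]
        congr 2
        field_simp
    _ ≤ _ := by
        refine ENNReal.tsum_le_tsum fun k => ?_
        refine le_trans (hN (N + d * k) (by lia) (y + h + α * d * k) ?_).2
          (Finset.sum_le_sum fun j hj => jumpProb_antitone _ ?_)
        · have : 0 ≤ α * d * (k : ℝ) := by positivity
          have : 0 ≤ α * (N + 1 + d : ℝ) := by positivity
          linarith
        · have : (j : ℝ) ≤ d := by exact_mod_cast (Finset.mem_range.1 hj).le
          nlinarith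

end JumpSum

/-! ### Independence of the next increment from the history -/

section Independence

variable {Ω : Type*} {mΩ : MeasurableSpace Ω} {μ : Measure Ω}

/-- Intersections of sets from `m₁` and `m₃` form a π-system on which the product formula follows by
applying the independence of `m₃` from `m₁ ⊔ m₂` twice. In the application `m₁` is the past, `m₂`
the next increment family and `m₃` the modulating process. -/
theorem Indep.sup_left_of_sup [IsProbabilityMeasure μ] {m₁ m₂ m₃ : MeasurableSpace Ω}
    (h₁ : m₁ ≤ mΩ) (h₂ : m₂ ≤ mΩ) (h₃ : m₃ ≤ mΩ) (h₁₂ : Indep m₁ m₂ μ)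
    (h : Indep (m₁ ⊔ m₂) m₃ μ) : Indep (m₁ ⊔ m₃) m₂ μ := by
  set p : Set (Set Ω) :=
    {u | ∃ s t, MeasurableSet[m₁] s ∧ MeasurableSet[m₃] t ∧ u = s ∩ t} with hp
  have hgen : m₁ ⊔ m₃ = MeasurableSpace.generateFrom p := by
    apply le_antisymm
    · refine sup_le (fun s hs => ?_) (fun t ht => ?_)
      · exact MeasurableSpace.measurableSet_generateFrom
          ⟨s, univ, hs, MeasurableSet.univ, (inter_univ s).symm⟩
      · exact MeasurableSpace.measurableSet_generateFrom
          ⟨univ, t, MeasurableSet.univ, ht, (univ_inter t).symm⟩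
    · refine MeasurableSpace.generateFrom_le ?_
      rintro _ ⟨s, t, hs, ht, rfl⟩
      exact MeasurableSet.inter ((le_sup_left : m₁ ≤ m₁ ⊔ m₃) s hs)
        ((le_sup_right : m₃ ≤ m₁ ⊔ m₃) t ht)
  refine IndepSets.indep (sup_le h₁ h₃) h₂ ?_ (@MeasurableSpace.isPiSystem_measurableSet Ω m₂)
    hgen (@MeasurableSpace.generateFrom_measurableSet Ω m₂).symm ?_
  · rintro _ ⟨s, t, hs, ht, rfl⟩ _ ⟨s', t', hs', ht', rfl⟩ -
    refine ⟨s ∩ s', t ∩ t', hs.inter hs', ht.inter ht', ?_⟩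
    rw [inter_inter_inter_comm]
  · rw [IndepSets_iff]
    rintro _ v ⟨s, t, hs, ht, rfl⟩ hv
    rw [Indep_iff] at h h₁₂
    have hs' : MeasurableSet[m₁ ⊔ m₂] s := (le_sup_left : m₁ ≤ m₁ ⊔ m₂) s hs
    have hv' : MeasurableSet[m₁ ⊔ m₂] v := (le_sup_right : m₂ ≤ m₁ ⊔ m₂) v hv
    rw [h s t hs' ht, inter_right_comm, h _ t (hs'.inter hv') ht, h₁₂ s v hs hv]
    ring

theorem lintegral_comp_of_indepFun [IsFiniteMeasure μ] {α β : Type*} [MeasurableSpace α]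
    [MeasurableSpace β] {U : Ω → α} {V : Ω → β} (hU : Measurable U) (hV : Measurable V)
    (h : IndepFun U V μ) {φ : α × β → ℝ≥0∞} (hφ : Measurable φ) :
    ∫⁻ ω, φ (U ω, V ω) ∂μ = ∫⁻ ω, ∫⁻ ω', φ (U ω, V ω') ∂μ ∂μ := by
  rw [← lintegral_map hφ (hU.prodMk hV),
    (indepFun_iff_map_prod_eq_prod_map_map hU.aemeasurable hV.aemeasurable).1 h,
    lintegral_prod _ hφ.aemeasurable, lintegral_map hφ.lintegral_prod_right' hU]
  refine lintegral_congr fun ω => ?_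
  exact lintegral_map (hφ.comp measurable_prodMk_left) hV

/-- The identity, seen as a map to `(Ω, m₁)` and as a map to `(Ω, m₂)`, gives two independent
variables. Thus freezing one argument needs no conditional distributions and no assumption on the
spaces. -/
theorem lintegral_diag_of_indep [IsFiniteMeasure μ] {m₁ m₂ : MeasurableSpace Ω} (h₁ : m₁ ≤ mΩ)
    (h₂ : m₂ ≤ mΩ) (h : Indep m₁ m₂ μ) {φ : Ω × Ω → ℝ≥0∞} (hφ : Measurable[m₁.prod m₂] φ) :
    ∫⁻ ω, φ (ω, ω) ∂μ = ∫⁻ ω, ∫⁻ ω', φ (ω, ω') ∂μ ∂μ := by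
  refine @lintegral_comp_of_indepFun Ω mΩ μ _ Ω Ω m₁ m₂ id id h₁ h₂ ?_ φ hφ
  rw [@IndepFun_iff_Indep, @MeasurableSpace.comap_id _ m₁, @MeasurableSpace.comap_id _ m₂]
  exact h

end Independence

section History

variable {E Ω : Type*} [mE : MeasurableSpace E] [mΩ : MeasurableSpace Ω]

/-- An increasing family of `σ`-algebras, the `N`-th of which contains the whole modulating process
and the first `N` increments, and is independent of the randomness of the following ones. -/
structure IsHistory (Pr : Measure Ω) (P : Kernel E ℝ) (X : ℕ → Ω → E) (ξ : ℕ → E → Ω → ℝ)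
    (𝓗 : ℕ → MeasurableSpace Ω) : Prop where
  mono : Monotone 𝓗
  le : ∀ N, 𝓗 N ≤ mΩ
  measurable_X : ∀ N n, 1 ≤ n → Measurable[𝓗 N] (X n)
  measurable_incr : ∀ N n, 1 ≤ n → n ≤ N → Measurable[𝓗 N] (fun ω => ξ n (X n ω) ω)
  lintegral_incr : ∀ N (A : Set Ω) (Y : Ω → ℝ) (f : ℝ × ℝ → ℝ≥0∞), MeasurableSet[𝓗 N] A →
    Measurable[𝓗 N] Y → Measurable f →
    ∫⁻ ω in A, f (Y ω, ξ (N + 1) (X (N + 1) ω) ω) ∂Pr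
      = ∫⁻ ω in A, ∫⁻ t, f (Y ω, t) ∂(P (X (N + 1) ω)) ∂Pr

/-- The `σ`-algebra generated by the modulating process. -/
abbrev modulationAlgebra (X : ℕ → Ω → E) : MeasurableSpace Ω := ⨆ n : ℕ+, mE.comap (X n)

/-- The history contains the whole modulating process, future included, so `X (N + 1)` is known when
the next increment is drawn. That increment can then be integrated out with the state frozen. -/
theorem IsModulated.exists_isHistory {Pr : Measure Ω} [IsProbabilityMeasure Pr] {P : Kernel E ℝ}
    {X : ℕ → Ω → E} {ξ : ℕ → E → Ω → ℝ} (h : IsModulated Pr P X ξ) :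
    ∃ 𝓗, IsHistory Pr P X ξ 𝓗 := by
  obtain ⟨𝒢, hle, hmeas, hind, hindX⟩ := h.indep
  have hXle : modulationAlgebra X ≤ mΩ := iSup_le fun n => (h.measurable_X n n.pos).comap_le
  set 𝓢 : ℕ → MeasurableSpace Ω := fun N => ⨆ n ∈ {n : ℕ+ | (n : ℕ) ≤ N}, 𝒢 n with h𝓢
  have h𝓢le : ∀ N, 𝓢 N ≤ mΩ := fun N => iSup₂_le fun n _ => hle n
  have hXm : ∀ N n, 1 ≤ n → Measurable[𝓢 N ⊔ modulationAlgebra X] (X n) := by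
    intro N n hn
    rw [measurable_iff_comap_le]
    exact (le_iSup (fun n : ℕ+ => mE.comap (X n)) ⟨n, hn⟩).trans le_sup_right
  refine ⟨fun N => 𝓢 N ⊔ modulationAlgebra X, ?_, fun N => sup_le (h𝓢le N) hXle, hXm, ?_, ?_⟩
  · intro M N hMN
    refine sup_le_sup_right (biSup_mono fun n hn => ?_) _
    exact le_trans hn hMN
  · intro N n hn hnN
    have h1 : 𝒢 ⟨n, hn⟩ ≤ 𝓢 N ⊔ modulationAlgebra X :=
      (le_biSup 𝒢 (show (⟨n, hn⟩ : ℕ+) ∈ {n : ℕ+ | (n : ℕ) ≤ N} from hnN)).trans le_sup_left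
    have h2 : @Measurable _ _ (𝓢 N ⊔ modulationAlgebra X) (mE.prod (𝒢 ⟨n, hn⟩))
        (fun ω => (X n ω, ω)) :=
      Measurable.prodMk (hXm N n hn) (show @Measurable _ _ (𝓢 N ⊔ modulationAlgebra X)
        (𝒢 ⟨n, hn⟩) (fun ω => ω) from fun s hs => h1 s hs)
    exact (hmeas ⟨n, hn⟩).comp h2
  · intro N A Y f hA hY hf
    set n : ℕ+ := ⟨N + 1, N.succ_pos⟩ with hn
    have hindep : Indep (𝓢 N ⊔ modulationAlgebra X) (𝒢 n) Pr := by
      refine Indep.sup_left_of_sup (h𝓢le N) (hle n) hXle ?_ ?_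
      · have := indep_iSup_of_disjoint hle hind (S := {n : ℕ+ | (n : ℕ) ≤ N}) (T := {n})
          (disjoint_singleton_right.2 fun hmem => absurd (show N + 1 ≤ N from hmem) (by lia))
        rwa [iSup_singleton] at this
      · exact indep_of_indep_of_le_left hindX
          (sup_le (iSup₂_le fun n _ => le_iSup 𝒢 n) (le_iSup 𝒢 n))
    have hAm : MeasurableSet A := (sup_le (h𝓢le N) hXle) A hA
    set φ : Ω × Ω → ℝ≥0∞ := fun p =>
      A.indicator (fun _ => 1) p.1 * f (Y p.1, ξ (N + 1) (X (N + 1) p.1) p.2) with hφ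
    have hφm : Measurable[(𝓢 N ⊔ modulationAlgebra X).prod (𝒢 n)] φ := by
      have hfst : @Measurable _ _ ((𝓢 N ⊔ modulationAlgebra X).prod (𝒢 n))
          (𝓢 N ⊔ modulationAlgebra X) (Prod.fst : Ω × Ω → Ω) :=
        @measurable_fst _ _ (𝓢 N ⊔ modulationAlgebra X) (𝒢 n)
      have hsnd : @Measurable _ _ ((𝓢 N ⊔ modulationAlgebra X).prod (𝒢 n)) (𝒢 n)
          (Prod.snd : Ω × Ω → Ω) :=
        @measurable_snd _ _ (𝓢 N ⊔ modulationAlgebra X) (𝒢 n)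
      have h1 : Measurable[𝓢 N ⊔ modulationAlgebra X] (A.indicator (fun _ => (1 : ℝ≥0∞))) :=
        measurable_const.indicator hA
      have h2 : @Measurable _ _ ((𝓢 N ⊔ modulationAlgebra X).prod (𝒢 n)) (mE.prod (𝒢 n))
          (fun p : Ω × Ω => (X (N + 1) p.1, p.2)) :=
        Measurable.prodMk ((hXm N (N + 1) (by lia)).comp hfst) hsnd
      have h3 := (hmeas n).comp h2
      have h4 := hY.comp hfst
      exact (h1.comp hfst).mul (hf.comp (h4.prodMk h3))
    have key := lintegral_diag_of_indep (sup_le (h𝓢le N) hXle) (hle n) hindep hφm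
    have hl : ∫⁻ ω in A, f (Y ω, ξ (N + 1) (X (N + 1) ω) ω) ∂Pr = ∫⁻ ω, φ (ω, ω) ∂Pr := by
      rw [← lintegral_indicator hAm]
      refine lintegral_congr fun ω => ?_
      by_cases hω : ω ∈ A <;> simp [hφ, hω]
    rw [hl, key, ← lintegral_indicator hAm]
    refine lintegral_congr fun ω => ?_
    have hξ : Measurable (ξ (N + 1) (X (N + 1) ω)) :=
      ((hmeas n).comp (@measurable_prodMk_left E Ω mE (𝒢 n) (X (N + 1) ω))).mono (hle n) le_rfl
    by_cases hω : ω ∈ A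
    · simp only [hφ, hω, indicator_of_mem, one_mul]
      rw [← h.law (N + 1) (by lia)]
      exact (lintegral_map (hf.comp measurable_prodMk_left) hξ).symm
    · simp [hφ, hω]

end History

/-! ### Stochastic domination by a walk with independent increments -/

section Domination

variable {μ ν : Measure ℝ} [IsProbabilityMeasure μ] [IsProbabilityMeasure ν]

theorem measure_Ici_le_of_tail_le (h : ∀ y, μ (Ioi y) ≤ ν (Ioi y)) (s : ℝ) :
    μ (Ici s) ≤ ν (Ici s) := by
  have key : ∀ ρ : Measure ℝ, IsProbabilityMeasure ρ →
      Tendsto (fun n : ℕ => ρ (Ioi (s - 1 / ((n : ℝ) + 1)))) atTop (𝓝 (ρ (Ici s))) := by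
    intro ρ hρ
    have hanti : Antitone fun n : ℕ => Ioi (s - 1 / ((n : ℝ) + 1)) := by
      intro m n hmn
      have : 1 / ((n : ℝ) + 1) ≤ 1 / ((m : ℝ) + 1) := Nat.one_div_le_one_div hmn
      exact Ioi_subset_Ioi (by linarith)
    have hlim := tendsto_measure_iInter_atTop (μ := ρ)
      (fun n : ℕ => (measurableSet_Ioi (a := s - 1 / ((n : ℝ) + 1))).nullMeasurableSet) hanti
      ⟨0, measure_ne_top _ _⟩
    convert! hlim using 3
    ext z
    simp only [mem_Ici, mem_iInter, mem_Ioi]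
    constructor
    · intro hz n
      have : 0 < 1 / ((n : ℝ) + 1) := Nat.one_div_pos_of_nat
      linarith
    · intro hz
      by_contra hlt
      obtain ⟨n, hn⟩ := exists_nat_one_div_lt (sub_pos.2 (not_le.1 hlt))
      linarith [hz n]
  exact le_of_tendsto_of_tendsto' (key μ inferInstance) (key ν inferInstance) fun n => h _

/-- An upper set of `ℝ` is empty, everything, or an open or closed half-line; the closed case is a
limit of open ones. -/
theorem measure_upperSet_le_of_tail_le (h : ∀ y, μ (Ioi y) ≤ ν (Ioi y)) {U : Set ℝ}
    (hU : IsUpperSet U) : μ U ≤ ν U := by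
  rcases U.eq_empty_or_nonempty with rfl | hne
  · simp
  by_cases hb : BddBelow U
  · by_cases hs : sInf U ∈ U
    · have : U = Ici (sInf U) := Subset.antisymm (fun x hx => csInf_le hb hx)
        fun x hx => hU hx hs
      rw [this]
      exact measure_Ici_le_of_tail_le h _
    · have : U = Ioi (sInf U) := by
        refine Subset.antisymm (fun x hx => ?_) fun x hx => ?_
        · exact lt_of_le_of_ne (csInf_le hb hx) fun he => hs (he ▸ hx)
        · obtain ⟨u, hu, hux⟩ := exists_lt_of_csInf_lt hne hx
          exact hU hux.le hu
      rw [this]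
      exact h _
  · have : U = univ := by
      refine eq_univ_of_forall fun x => ?_
      rw [not_bddBelow_iff] at hb
      obtain ⟨u, hu, hux⟩ := hb x
      exact hU hux.le hu
    simp [this]

theorem lintegral_mono_of_tail_le (h : ∀ y, μ (Ioi y) ≤ ν (Ioi y)) {f : ℝ → ℝ}
    (hf : Monotone f) (h0 : ∀ t, 0 ≤ f t) :
    ∫⁻ t, ENNReal.ofReal (f t) ∂μ ≤ ∫⁻ t, ENNReal.ofReal (f t) ∂ν := by
  rw [lintegral_eq_lintegral_meas_lt μ (Eventually.of_forall h0) hf.measurable.aemeasurable,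
    lintegral_eq_lintegral_meas_lt ν (Eventually.of_forall h0) hf.measurable.aemeasurable]
  exact lintegral_mono fun t => measure_upperSet_le_of_tail_le h
    fun a b hab ha => lt_of_lt_of_le ha (hf hab)

end Domination

/-! ### Passage probabilities of a walk with independent steps. -/

section Exceed

/-- The probability that a random walk with step law `G`, started at `0`, exceeds the level `y`
within `n` steps. -/
noncomputable def exceedWithin (G : Measure ℝ) : ℕ → ℝ → ℝ≥0∞
  | 0, y => if y < 0 then 1 else 0
  | n + 1, y => if y < 0 then 1 else ∫⁻ t, exceedWithin G n (y - t) ∂G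

/-- The probability that a random walk with step law `G`, started at `0`, ever exceeds the level
`y`. -/
noncomputable def exceedProb (G : Measure ℝ) (y : ℝ) : ℝ≥0∞ := ⨆ n, exceedWithin G n y

variable {G : Measure ℝ}

theorem exceedWithin_of_neg (n : ℕ) {y : ℝ} (hy : y < 0) : exceedWithin G n y = 1 := by
  cases n <;> simp [exceedWithin, hy]

variable [IsProbabilityMeasure G]

theorem exceedWithin_le_one (n : ℕ) (y : ℝ) : exceedWithin G n y ≤ 1 := by
  induction n generalizing y with
  | zero =>
    unfold exceedWithin
    split_ifs <;> simp
  | succ n ih =>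
    unfold exceedWithin
    split_ifs
    · exact le_rfl
    · calc ∫⁻ t, exceedWithin G n (y - t) ∂G ≤ ∫⁻ _, 1 ∂G := lintegral_mono fun t => ih _
        _ = 1 := by simp

theorem exceedWithin_antitone (n : ℕ) : Antitone (exceedWithin G n) := by
  induction n with
  | zero =>
    intro x y hxy
    unfold exceedWithin
    split_ifs with h1 h2
    · exact le_rfl
    · linarith
    · exact zero_le
    · exact le_rfl
  | succ n ih =>
    intro x y hxy
    rcases lt_or_ge x 0 with hx | hx
    · rw [exceedWithin_of_neg _ hx]
      exact exceedWithin_le_one _ _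
    · unfold exceedWithin
      rw [if_neg (not_lt.2 hx), if_neg (not_lt.2 (hx.trans hxy))]
      exact lintegral_mono fun t => ih (by linarith)

theorem exceedProb_antitone : Antitone (exceedProb G) := fun _ _ h =>
  iSup_mono fun n => exceedWithin_antitone n h

theorem exceedProb_le_one (y : ℝ) : exceedProb G y ≤ 1 := iSup_le fun n => exceedWithin_le_one n y

/-- One step of the comparison: the passage probability decreases in the level, hence increases with
the step just taken. -/
theorem lintegral_exceedWithin_mono {μ ν : Measure ℝ} [IsProbabilityMeasure μ]
    [IsProbabilityMeasure ν] (h : ∀ y, μ (Ioi y) ≤ ν (Ioi y)) (n : ℕ) (z : ℝ) :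
    ∫⁻ t, exceedWithin G n (z - t) ∂μ ≤ ∫⁻ t, exceedWithin G n (z - t) ∂ν := by
  have hne : ∀ y, exceedWithin G n y ≠ ∞ := fun y =>
    ((exceedWithin_le_one n y).trans_lt ENNReal.one_lt_top).ne
  have hmono : Monotone fun t => (exceedWithin G n (z - t)).toReal := fun s t hst =>
    ENNReal.toReal_mono (hne _) (exceedWithin_antitone n (by linarith))
  have := lintegral_mono_of_tail_le h hmono fun t => ENNReal.toReal_nonneg
  simpa only [ENNReal.ofReal_toReal (hne _)] using this

end Exceed

/-! ### Comparison of the modulated walk with the walk of step law `G`. -/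

section Walk

variable {E Ω : Type*} {X : ℕ → Ω → E} {ξ : ℕ → E → Ω → ℝ}

@[simp]
theorem walk_zero (ω : Ω) : walk X ξ 0 ω = 0 := by simp [walk]

theorem walk_succ (n : ℕ) (ω : Ω) :
    walk X ξ (n + 1) ω = walk X ξ n ω + ξ (n + 1) (X (n + 1) ω) ω := by
  rw [walk, walk, Finset.sum_Icc_succ_top (by lia)]

variable [MeasurableSpace E] [mΩ : MeasurableSpace Ω] {Pr : Measure Ω} {P : Kernel E ℝ}
  {𝓗 : ℕ → MeasurableSpace Ω}

theorem IsHistory.measurable_walk (h : IsHistory Pr P X ξ 𝓗) {n N : ℕ} (hn : n ≤ N) :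
    Measurable[𝓗 N] (walk X ξ n) := by
  refine Finset.measurable_fun_sum _ fun i hi => ?_
  rw [Finset.mem_Icc] at hi
  exact h.measurable_incr N i hi.1 (hi.2.trans hn)

theorem IsHistory.measurable_walk' (h : IsHistory Pr P X ξ 𝓗) (n : ℕ) :
    Measurable (walk X ξ n) := (h.measurable_walk le_rfl).mono (h.le n) le_rfl

variable {G : Measure ℝ}

theorem IsHistory.measure_exceed_zero (h : IsHistory Pr P X ξ 𝓗) (N : ℕ) (A : Set Ω) (y : ℝ) :
    Pr (A ∩ {ω | ∃ k ≤ 0, y < walk X ξ (N + k) ω})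
      = ∫⁻ ω in A, exceedWithin G 0 (y - walk X ξ N ω) ∂Pr := by
  have hm : MeasurableSet {ω | y < walk X ξ N ω} :=
    measurableSet_lt measurable_const (h.measurable_walk' N)
  have : ∀ ω, exceedWithin G 0 (y - walk X ξ N ω)
      = {ω | y < walk X ξ N ω}.indicator (fun _ => 1) ω := fun ω => by
    simp [exceedWithin, indicator_apply]
  simp only [this]
  rw [lintegral_indicator hm, setLIntegral_one, Measure.restrict_apply hm, inter_comm]
  congr 2
  ext ω
  simp

theorem IsHistory.measure_exceed_succ (h : IsHistory Pr P X ξ 𝓗) (n N : ℕ) (A : Set Ω) (y : ℝ) :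
    Pr (A ∩ {ω | ∃ k ≤ n + 1, y < walk X ξ (N + k) ω})
      = Pr (A ∩ {ω | y < walk X ξ N ω})
        + Pr ((A ∩ {ω | y < walk X ξ N ω}ᶜ) ∩ {ω | ∃ k ≤ n, y < walk X ξ (N + 1 + k) ω}) := by
  have hm : MeasurableSet {ω | y < walk X ξ N ω} :=
    measurableSet_lt measurable_const (h.measurable_walk' N)
  rw [← measure_inter_add_sdiff _ hm]
  congr 2
  · ext ω
    simp only [mem_inter_iff, mem_ofPred_eq]
    exact ⟨fun hω => ⟨hω.1.1, hω.2⟩, fun hω => ⟨⟨hω.1, 0, by lia, hω.2⟩, hω.2⟩⟩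
  · ext ω
    simp only [mem_inter_iff, mem_ofPred_eq, Set.mem_sdiff, mem_compl_iff]
    constructor
    · rintro ⟨⟨h1, k, hk, h2⟩, h3⟩
      rcases k with _ | k
      · exact absurd h2 h3
      · exact ⟨⟨h1, h3⟩, k, by lia, by rwa [show N + 1 + k = N + (k + 1) by lia]⟩
    · rintro ⟨⟨h1, h3⟩, k, hk, h2⟩
      exact ⟨⟨h1, k + 1, by lia, by rwa [show N + (k + 1) = N + 1 + k by lia]⟩, h3⟩

theorem IsHistory.lintegral_exceedWithin_succ (h : IsHistory Pr P X ξ 𝓗) (n N : ℕ) {A : Set Ω}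
    (hA : MeasurableSet[𝓗 N] A) (y : ℝ) :
    ∫⁻ ω in A, exceedWithin G (n + 1) (y - walk X ξ N ω) ∂Pr
      = Pr (A ∩ {ω | y < walk X ξ N ω})
        + ∫⁻ ω in A ∩ {ω | y < walk X ξ N ω}ᶜ,
            ∫⁻ t, exceedWithin G n (y - walk X ξ N ω - t) ∂G ∂Pr := by
  have hm : MeasurableSet {ω | y < walk X ξ N ω} :=
    measurableSet_lt measurable_const (h.measurable_walk' N)
  have hAm := h.le N A hA
  rw [← lintegral_inter_add_sdiff _ A hm]
  congr 1
  · rw [← setLIntegral_one]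
    refine setLIntegral_congr_fun (hAm.inter hm) fun ω hω => ?_
    exact exceedWithin_of_neg _ (sub_neg.2 hω.2)
  · refine setLIntegral_congr_fun (hAm.diff hm) fun ω hω => ?_
    have : ¬ y - walk X ξ N ω < 0 := fun hlt => hω.2 (sub_neg.1 hlt)
    simp only [exceedWithin, if_neg this]

variable [IsProbabilityMeasure G]

theorem IsHistory.lintegral_exceedWithin_walk_succ (h : IsHistory Pr P X ξ 𝓗) (n N : ℕ)
    {A : Set Ω} (hA : MeasurableSet[𝓗 N] A) (y : ℝ) :
    ∫⁻ ω in A, exceedWithin G n (y - walk X ξ (N + 1) ω) ∂Pr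
      = ∫⁻ ω in A, ∫⁻ t, exceedWithin G n (y - walk X ξ N ω - t) ∂(P (X (N + 1) ω)) ∂Pr := by
  have := h.lintegral_incr N A (fun ω => y - walk X ξ N ω)
    (fun p => exceedWithin G n (p.1 - p.2)) hA
    (measurable_const.sub (h.measurable_walk le_rfl))
    ((exceedWithin_antitone n).measurable.comp (measurable_fst.sub measurable_snd))
  rw [← this]
  refine lintegral_congr fun ω => ?_
  rw [walk_succ, sub_sub]

theorem IsHistory.measurableSet_inter_compl (h : IsHistory Pr P X ξ 𝓗) {N : ℕ} {A : Set Ω}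
    (hA : MeasurableSet[𝓗 N] A) (y : ℝ) :
    MeasurableSet[𝓗 (N + 1)] (A ∩ {ω | y < walk X ξ N ω}ᶜ) :=
  h.mono N.le_succ _ (hA.inter (measurableSet_lt measurable_const (h.measurable_walk le_rfl)).compl)

/-- Induction on the number of remaining steps replaces a coupling: on the part of `A` where the
level is not yet exceeded, the induction hypothesis applies at time `N + 1`, and the law of the
increment just taken is replaced by `G`. This is why `N` and the past event `A` are arbitrary. -/
theorem IsHistory.measure_exceedWithin_le [IsMarkovKernel P] (h : IsHistory Pr P X ξ 𝓗)
    (hG : ∀ x y, P x (Ioi y) ≤ G (Ioi y)) (n N : ℕ) {A : Set Ω} (hA : MeasurableSet[𝓗 N] A)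
    (y : ℝ) :
    Pr (A ∩ {ω | ∃ k ≤ n, y < walk X ξ (N + k) ω})
      ≤ ∫⁻ ω in A, exceedWithin G n (y - walk X ξ N ω) ∂Pr := by
  induction n generalizing N A with
  | zero => exact (h.measure_exceed_zero N A y).le
  | succ n ih =>
    rw [h.measure_exceed_succ n N A, h.lintegral_exceedWithin_succ n N hA]
    refine add_le_add_right ((ih (N + 1) (h.measurableSet_inter_compl hA y)).trans ?_) _
    rw [h.lintegral_exceedWithin_walk_succ n N (hA.inter
      (measurableSet_lt measurable_const (h.measurable_walk le_rfl)).compl)]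
    exact lintegral_mono fun ω => lintegral_exceedWithin_mono (fun y => hG _ y) n _

/-- Identifies the recursively defined passage probabilities with those of an actual walk, so that
path decompositions can be applied to `exceedProb`. -/
theorem IsHistory.measure_exceedWithin_eq (h : IsHistory Pr P X ξ 𝓗) (hG : ∀ x, P x = G)
    (n N : ℕ) {A : Set Ω} (hA : MeasurableSet[𝓗 N] A) (y : ℝ) :
    Pr (A ∩ {ω | ∃ k ≤ n, y < walk X ξ (N + k) ω})
      = ∫⁻ ω in A, exceedWithin G n (y - walk X ξ N ω) ∂Pr := by
  induction n generalizing N A with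
  | zero => exact h.measure_exceed_zero N A y
  | succ n ih =>
    rw [h.measure_exceed_succ n N A, h.lintegral_exceedWithin_succ n N hA,
      ih (N + 1) (h.measurableSet_inter_compl hA y), h.lintegral_exceedWithin_walk_succ n N
        (hA.inter (measurableSet_lt measurable_const (h.measurable_walk le_rfl)).compl)]
    simp only [hG]

theorem IsHistory.measure_exceed_le [IsMarkovKernel P] (h : IsHistory Pr P X ξ 𝓗)
    (hG : ∀ x y, P x (Ioi y) ≤ G (Ioi y)) (N : ℕ) {A : Set Ω} (hA : MeasurableSet[𝓗 N] A)
    (y : ℝ) :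
    Pr (A ∩ {ω | ∃ k, y < walk X ξ (N + k) ω})
      ≤ ∫⁻ ω in A, exceedProb G (y - walk X ξ N ω) ∂Pr := by
  have hU : A ∩ {ω | ∃ k, y < walk X ξ (N + k) ω}
      = ⋃ n, A ∩ {ω | ∃ k ≤ n, y < walk X ξ (N + k) ω} := by
    ext ω
    simp only [mem_inter_iff, mem_ofPred_eq, mem_iUnion]
    exact ⟨fun ⟨h1, k, h2⟩ => ⟨k, h1, k, le_rfl, h2⟩, fun ⟨n, h1, k, _, h2⟩ => ⟨h1, k, h2⟩⟩
  have hmono : Monotone fun n => A ∩ {ω | ∃ k ≤ n, y < walk X ξ (N + k) ω} :=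
    fun m n hmn => inter_subset_inter_right _ fun ω ⟨k, hk, hω⟩ => ⟨k, hk.trans hmn, hω⟩
  rw [hU, hmono.measure_iUnion]
  refine iSup_le fun n => (h.measure_exceedWithin_le hG n N hA y).trans ?_
  exact lintegral_mono fun ω => le_iSup (fun n => exceedWithin G n (y - walk X ξ N ω)) n

theorem IsHistory.exceedProb_le [IsProbabilityMeasure Pr] (h : IsHistory Pr P X ξ 𝓗)
    (hG : ∀ x, P x = G) (y : ℝ) :
    exceedProb G y ≤ Pr {ω | ∃ k, y < walk X ξ k ω} := by
  refine iSup_le fun n => ?_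
  have := h.measure_exceedWithin_eq hG n 0 (A := univ) MeasurableSet.univ y
  simp only [walk_zero, sub_zero, Measure.restrict_univ, lintegral_const, measure_univ, mul_one,
    univ_inter, zero_add] at this
  rw [← this]
  exact measure_mono fun ω ⟨k, _, hk⟩ => ⟨k, hk⟩

end Walk

/-! ### Decomposition at the first passage over a receding barrier -/

/-- The event that the walk passes above the barrier `K - α n` for the first time at time `n`. -/
def firstPassage {E Ω : Type*} (X : ℕ → Ω → E) (ξ : ℕ → E → Ω → ℝ) (K α : ℝ) (n : ℕ) : Set Ω :=
  {ω | K - α * n < walk X ξ n ω ∧ ∀ k < n, walk X ξ k ω ≤ K - α * k}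

section Barrier

variable {Ω : Type*} [MeasurableSpace Ω] {Pr : Measure Ω}

/-- Tightness of an almost surely finite supremum, by continuity from above along integer levels. -/
theorem exists_measure_exists_gt_le [IsProbabilityMeasure Pr] {f : ℕ → Ω → ℝ}
    (hf : ∀ n, Measurable (f n)) (hb : ∀ᵐ ω ∂Pr, BddAbove (range fun n => f n ω)) {δ : ℝ≥0∞} (hδ : 0 < δ) :
    ∃ K : ℝ, 0 ≤ K ∧ Pr {ω | ∃ n, K < f n ω} ≤ δ := by
  have hmeas : ∀ K : ℕ, MeasurableSet {ω | ∃ n, (K : ℝ) < f n ω} := fun K => by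
    have : {ω | ∃ n, (K : ℝ) < f n ω} = ⋃ n, {ω | (K : ℝ) < f n ω} := by
      ext ω
      simp
    rw [this]
    exact MeasurableSet.iUnion fun n => measurableSet_lt measurable_const (hf n)
  have hanti : Antitone fun K : ℕ => {ω | ∃ n, (K : ℝ) < f n ω} := by
    intro K K' hK ω ⟨n, hn⟩
    exact ⟨n, lt_of_le_of_lt (by exact_mod_cast hK) hn⟩
  have hlim := tendsto_measure_iInter_atTop (μ := Pr) (fun K => (hmeas K).nullMeasurableSet) hanti
    ⟨0, measure_ne_top _ _⟩
  have hzero : Pr (⋂ K : ℕ, {ω | ∃ n, (K : ℝ) < f n ω}) = 0 := by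
    rw [← nonpos_iff_eq_zero, ← ae_iff.1 hb]
    refine measure_mono fun ω hω hbdd => ?_
    obtain ⟨b, hbd⟩ := hbdd
    obtain ⟨K, hK⟩ := exists_nat_ge b
    obtain ⟨n, hn⟩ := mem_iInter.1 hω K
    have : f n ω ≤ b := hbd ⟨n, rfl⟩
    linarith
  rw [hzero] at hlim
  obtain ⟨K, hK⟩ := (hlim.eventually (gt_mem_nhds hδ)).exists
  exact ⟨K, by positivity, hK.le⟩

variable {E : Type*} [MeasurableSpace E] {X : ℕ → Ω → E} {ξ : ℕ → E → Ω → ℝ} {P : Kernel E ℝ}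
  {𝓗 : ℕ → MeasurableSpace Ω} {a : ℝ}

/-- As `α < a`, the process `S_n + α n` is eventually negative, so its supremum is almost surely
finite. `exists_lower_barrier` is the mirror image for slopes beyond `a`. -/
theorem IsHistory.exists_barrier [IsProbabilityMeasure Pr] (h : IsHistory Pr P X ξ 𝓗)
    (hd : HasDrift Pr X ξ a) {α : ℝ} (hα : α < a) {δ : ℝ≥0∞} (hδ : 0 < δ) :
    ∃ K : ℝ, 0 ≤ K ∧ Pr {ω | ∃ n : ℕ, K - α * n < walk X ξ n ω} ≤ δ := by
  have hb : ∀ᵐ ω ∂Pr, BddAbove (range fun n : ℕ => walk X ξ n ω + α * n) := by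
    filter_upwards [hd] with ω hω
    refine IsBoundedUnder.bddAbove_range ⟨0, ?_⟩
    rw [eventually_map]
    filter_upwards [hω.eventually (gt_mem_nhds (show -a < -α by linarith)),
      eventually_gt_atTop 0] with n hn hn0
    rw [div_lt_iff₀ (by exact_mod_cast hn0)] at hn
    linarith
  obtain ⟨K, hK0, hK⟩ := exists_measure_exists_gt_le (Pr := Pr)
    (f := fun n ω => walk X ξ n ω + α * n) (fun n => (h.measurable_walk' n).add_const _) hb hδ
  refine ⟨K, hK0, le_trans (measure_mono ?_) hK⟩
  rintro ω ⟨n, hn⟩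
  exact ⟨n, by linarith⟩

theorem IsHistory.exists_lower_barrier [IsProbabilityMeasure Pr] (h : IsHistory Pr P X ξ 𝓗)
    (hd : HasDrift Pr X ξ a) {β : ℝ} (hβ : a < β) {δ : ℝ≥0∞} (hδ : 0 < δ) :
    ∃ K : ℝ, 0 ≤ K ∧ Pr {ω | ∃ n : ℕ, walk X ξ n ω < -K - β * n} ≤ δ := by
  have hb : ∀ᵐ ω ∂Pr, BddAbove (range fun n : ℕ => -walk X ξ n ω - β * n) := by
    filter_upwards [hd] with ω hω
    refine IsBoundedUnder.bddAbove_range ⟨0, ?_⟩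
    rw [eventually_map]
    filter_upwards [hω.eventually (lt_mem_nhds (show -β < -a by linarith)),
      eventually_gt_atTop 0] with n hn hn0
    rw [lt_div_iff₀ (by exact_mod_cast hn0)] at hn
    linarith
  obtain ⟨K, hK0, hK⟩ := exists_measure_exists_gt_le (Pr := Pr)
    (f := fun n ω => -walk X ξ n ω - β * n) (fun n => (h.measurable_walk' n).neg.sub_const _) hb hδ
  refine ⟨K, hK0, le_trans (measure_mono ?_) hK⟩
  rintro ω ⟨n, hn⟩
  exact ⟨n, by linarith⟩

theorem IsHistory.measure_inter_incr_gt (h : IsHistory Pr P X ξ 𝓗) (N : ℕ) {A : Set Ω}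
    (hA : MeasurableSet[𝓗 N] A) (z : ℝ) :
    Pr (A ∩ {ω | z < ξ (N + 1) (X (N + 1) ω) ω}) = ∫⁻ ω in A, P (X (N + 1) ω) (Ioi z) ∂Pr := by
  have hm : MeasurableSet {ω | z < ξ (N + 1) (X (N + 1) ω) ω} := measurableSet_lt measurable_const
    ((h.measurable_incr (N + 1) (N + 1) (by lia) le_rfl).mono (h.le _) le_rfl)
  have := h.lintegral_incr N A (fun _ => 0) (fun p => (Ioi z).indicator (fun _ => 1) p.2) hA
    measurable_const ((measurable_const.indicator measurableSet_Ioi).comp measurable_snd)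
  simp only [lintegral_indicator_const measurableSet_Ioi, one_mul] at this
  rw [← this, inter_comm, ← Measure.restrict_apply hm, ← lintegral_indicator_one hm]
  rfl

theorem IsHistory.measurableSet_firstPassage (h : IsHistory Pr P X ξ 𝓗) (K α : ℝ) (n : ℕ) :
    MeasurableSet[𝓗 n] (firstPassage X ξ K α n) := by
  have : {ω | ∀ k < n, walk X ξ k ω ≤ K - α * k}
      = ⋂ k ∈ Finset.range n, {ω | walk X ξ k ω ≤ K - α * k} := by
    ext ω
    simp
  refine MeasurableSet.inter (s₂ := {ω | ∀ k < n, walk X ξ k ω ≤ K - α * k})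
    (measurableSet_lt measurable_const (h.measurable_walk le_rfl)) ?_
  rw [this]
  refine Finset.measurableSet_biInter _ fun k hk => ?_
  exact measurableSet_le (h.measurable_walk (Finset.mem_range.1 hk).le) measurable_const

/-- The law of the position at the first passage over a receding barrier, and the bound for the
probability to exceed a high level that it gives. -/
theorem IsHistory.exists_passage_law [IsProbabilityMeasure Pr] [IsMarkovKernel P] {G : Measure ℝ}
    [IsProbabilityMeasure G]
    (h : IsHistory Pr P X ξ 𝓗) (hG : ∀ x y, P x (Ioi y) ≤ G (Ioi y)) (hd : HasDrift Pr X ξ a)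
    {α : ℝ} (hα0 : 0 < α) (hα : α < a) {δ : ℝ≥0∞} (hδ : 0 < δ) :
    ∃ (K : ℝ) (ρ : Measure ℝ), ρ univ ≤ δ ∧ (∀ z, ρ (Ioi z) ≤ jumpSum Pr P X univ α (z - K)) ∧
      ∀ v y, K ≤ y → Pr {ω | ∃ k, y < walk X ξ k ω}
        ≤ ρ (Ioi v) + ∫⁻ s in Iic v, exceedProb G (y - s) ∂ρ := by
  obtain ⟨K, hK0, hK⟩ := h.exists_barrier hd hα hδ
  -- Time `0` may be left out: the walk starts at `0 ≤ K`, on or below the barrier.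
  set A : ℕ → Set Ω := fun n => firstPassage X ξ K α (n + 1) with hA
  have hAm : ∀ n, MeasurableSet[𝓗 (n + 1)] (A n) := fun n => h.measurableSet_firstPassage K α _
  have hAm' : ∀ n, MeasurableSet (A n) := fun n => h.le _ _ (hAm n)
  have hS : ∀ n, Measurable (walk X ξ n) := h.measurable_walk'
  have hdisj : Pairwise (Function.onFun Disjoint A) := by
    intro i j hij
    refine Set.disjoint_left.2 fun ω hi hj => ?_
    rcases lt_or_gt_of_ne hij with hlt | hlt
    · exact absurd hi.1 (not_lt.2 (hj.2 (i + 1) (by lia)))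
    · exact absurd hj.1 (not_lt.2 (hi.2 (j + 1) (by lia)))
  set ρ : Measure ℝ := Measure.sum fun n => (Pr.restrict (A n)).map (walk X ξ (n + 1)) with hρ
  have hρIoi : ∀ z, ρ (Ioi z) = ∑' n, Pr (A n ∩ {ω | z < walk X ξ (n + 1) ω}) := by
    intro z
    rw [hρ, Measure.sum_apply _ measurableSet_Ioi]
    refine tsum_congr fun n => ?_
    rw [Measure.map_apply (hS _) measurableSet_Ioi,
      Measure.restrict_apply ((hS _) measurableSet_Ioi), inter_comm]
    rfl
  -- Before the passage the walk is at most `K - α n`, so ending above `z` takes an increment above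
  -- `z - K + α n = z - (K + α) + α (n + 1)`; the extra `α` is the index shift.
  refine ⟨K + α, ρ, ?_, fun z => ?_, fun v y hy => ?_⟩
  · rw [hρ, Measure.sum_apply _ MeasurableSet.univ]
    simp only [Measure.map_apply (hS _) MeasurableSet.univ, preimage_univ,
      Measure.restrict_apply_univ]
    rw [← measure_iUnion hdisj hAm']
    refine le_trans (measure_mono (iUnion_subset fun n ω hω => ?_)) hK
    exact ⟨n + 1, hω.1⟩
  · rw [hρIoi, jumpSum]
    refine ENNReal.tsum_le_tsum fun n => ?_
    have h1 := h.measure_inter_incr_gt n (A := univ) MeasurableSet.univ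
      (z - (K + α) + α * (n + 1))
    rw [jumpProb, preimage_univ, ← h1, univ_inter]
    refine measure_mono fun ω hω => ?_
    have h2 : walk X ξ n ω ≤ K - α * n := hω.1.2 n (by lia)
    have h3 : z < walk X ξ (n + 1) ω := hω.2
    rw [walk_succ] at h3
    change z - (K + α) + α * (n + 1) < ξ (n + 1) (X (n + 1) ω) ω
    linarith
  -- A level `y` not below `K` cannot be exceeded before the receding barrier is crossed; `v` splits
  -- the position at the crossing.
  · have hsub : {ω | ∃ k, y < walk X ξ k ω} ⊆ ⋃ n, (A n ∩ {ω | v < walk X ξ (n + 1) ω}) ∪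
        ((A n ∩ {ω | walk X ξ (n + 1) ω ≤ v}) ∩ {ω | ∃ k, y < walk X ξ (n + 1 + k) ω}) := by
      rintro ω ⟨k, hk⟩
      classical
      have hex : ∃ n : ℕ, K - α * n < walk X ξ n ω := ⟨k, by
        have : 0 ≤ α * k := by positivity
        linarith⟩
      have hpass : ω ∈ firstPassage X ξ K α (Nat.find hex) :=
        ⟨Nat.find_spec hex, fun j hj => not_lt.1 (Nat.find_min hex hj)⟩
      have hle : Nat.find hex ≤ k := Nat.find_min' hex (by
        have : 0 ≤ α * k := by positivity
        linarith)
      obtain ⟨n, hn⟩ : ∃ n, Nat.find hex = n + 1 := by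
        refine Nat.exists_eq_succ_of_ne_zero fun h0 => ?_
        have h1 := Nat.find_spec hex
        rw [h0] at h1
        simp only [Nat.cast_zero, mul_zero, sub_zero, walk_zero] at h1
        linarith
      rw [hn] at hpass hle
      refine mem_iUnion.2 ⟨n, ?_⟩
      rcases lt_or_ge v (walk X ξ (n + 1) ω) with hv | hv
      · exact Or.inl ⟨hpass, hv⟩
      · exact Or.inr ⟨⟨hpass, hv⟩, k - (n + 1), by rwa [Nat.add_sub_cancel' hle]⟩
    have hint : ∫⁻ s in Iic v, exceedProb G (y - s) ∂ρ
        = ∑' n, ∫⁻ ω in A n ∩ {ω | walk X ξ (n + 1) ω ≤ v},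
            exceedProb G (y - walk X ξ (n + 1) ω) ∂Pr := by
      rw [hρ, Measure.restrict_sum _ measurableSet_Iic, lintegral_sum_measure]
      refine tsum_congr fun n => ?_
      have hm : Measurable fun s => exceedProb G (y - s) :=
        exceedProb_antitone.measurable.comp (measurable_const.sub measurable_id)
      rw [setLIntegral_map measurableSet_Iic hm (hS _),
        Measure.restrict_restrict ((hS _) measurableSet_Iic), inter_comm]
      rfl
    rw [hint, hρIoi, ← ENNReal.tsum_add]
    refine (measure_mono hsub).trans ((measure_iUnion_le _).trans ?_)
    refine ENNReal.tsum_le_tsum fun n => (measure_union_le _ _).trans (add_le_add_right ?_ _)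
    exact h.measure_exceed_le hG (n + 1)
      ((hAm n).inter (measurableSet_le (h.measurable_walk le_rfl) measurable_const)) y

end Barrier

/-! ### The dominating walk -/

section DominatingLaw

theorem measureReal_Ioi_eq_cdf (μ : Measure ℝ) [IsProbabilityMeasure μ] (y : ℝ) :
    μ.real (Ioi y) = 1 - cdf μ y := by
  rw [cdf_eq_real, measureReal_Iic_eq, sub_sub_cancel]

/-- The distribution function whose tail is the minimum of the tail of `G` and of `L` times the
tail of `F`. -/
noncomputable def minTailCDF (G F : Measure ℝ) (L : ℝ) (hL : 0 ≤ L) : StieltjesFunction ℝ where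
  toFun y := max (cdf G y) (1 - L * (1 - cdf F y))
  mono' x y h := by
    have h1 := monotone_cdf G h
    have h2 := monotone_cdf F h
    dsimp only
    gcongr
  right_continuous' x := ((cdf G).right_continuous x).max (continuousWithinAt_const.sub
    (continuousWithinAt_const.mul (continuousWithinAt_const.sub ((cdf F).right_continuous x))))

/-- The positive parts compare by stochastic order, and the negative parts have equal integrals
because the two laws agree on the negative half-line. -/
theorem integrable_and_integral_le_of_tail {G G' : Measure ℝ} [IsProbabilityMeasure G]
    [IsProbabilityMeasure G'] (hG : Integrable (fun t : ℝ => t) G)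
    (hle : ∀ y, G' (Ioi y) ≤ G (Ioi y)) (heq : ∀ y < 0, G' (Iic y) = G (Iic y)) :
    Integrable (fun t : ℝ => t) G' ∧ ∫ t, t ∂G' ≤ ∫ t, t ∂G := by
  have hmax : ∀ t : ℝ, ENNReal.ofReal (max t 0) = ENNReal.ofReal t := fun t => by
    rcases le_total t 0 with h | h
    · rw [max_eq_right h, ENNReal.ofReal_zero, ENNReal.ofReal_of_nonpos h]
    · rw [max_eq_left h]
  have hpos : ∫⁻ t, ENNReal.ofReal t ∂G' ≤ ∫⁻ t, ENNReal.ofReal t ∂G := by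
    have := lintegral_mono_of_tail_le hle (f := fun t => max t 0)
      (fun s t h => max_le_max_right 0 h) (fun t => le_max_right _ _)
    simpa only [hmax] using this
  have hneg : ∫⁻ t, ENNReal.ofReal (-t) ∂G' = ∫⁻ t, ENNReal.ofReal (-t) ∂G := by
    have key : ∀ ρ : Measure ℝ, ∫⁻ t, ENNReal.ofReal (-t) ∂ρ = ∫⁻ s in Ioi 0, ρ (Iic (-s)) := by
      intro ρ
      have := lintegral_eq_lintegral_meas_le ρ (f := fun t => max (-t) 0)
        (Eventually.of_forall fun t => le_max_right _ _) (by fun_prop)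
      simp only [hmax] at this
      rw [this]
      refine setLIntegral_congr_fun measurableSet_Ioi fun s hs => ?_
      congr 1
      ext t
      have hs' : (0 : ℝ) < s := hs
      simp [not_le.2 hs', le_neg]
    rw [key, key]
    exact setLIntegral_congr_fun measurableSet_Ioi fun s hs => heq _ (neg_lt_zero.2 hs)
  have hposG := (Integrable.lintegral_lt_top hG)
  have hnegG := (Integrable.lintegral_lt_top hG.neg)
  simp only [Pi.neg_apply] at hnegG
  have hint : Integrable (fun t : ℝ => t) G' := by
    refine ⟨measurable_id.aestronglyMeasurable, ?_⟩
    rw [hasFiniteIntegral_iff_norm]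
    have : ∀ t : ℝ, ENNReal.ofReal ‖t‖ = ENNReal.ofReal t + ENNReal.ofReal (-t) := fun t => by
      rcases le_total t 0 with h | h
      · rw [Real.norm_of_nonpos h, ENNReal.ofReal_of_nonpos h, zero_add]
      · rw [Real.norm_of_nonneg h, ENNReal.ofReal_of_nonpos (neg_nonpos.2 h), add_zero]
    simp only [this]
    rw [lintegral_add_left ENNReal.measurable_ofReal, hneg]
    exact ENNReal.add_lt_top.2 ⟨hpos.trans_lt hposG, hnegG⟩
  refine ⟨hint, ?_⟩
  rw [integral_eq_lintegral_pos_part_sub_lintegral_neg_part hint,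
    integral_eq_lintegral_pos_part_sub_lintegral_neg_part hG, hneg]
  gcongr
  exact hposG.ne

/-- The given dominating law may have a much heavier tail than `F`; cutting its tail at `L F̄` keeps
the domination of every `F_x`. Since `F̄ = 1` on the negatives and `L ≥ 1`, nothing changes there,
so the mean can only decrease and stays negative. -/
theorem exists_law_min_tail {G F : Measure ℝ} [IsProbabilityMeasure G] [IsProbabilityMeasure F]
    (hF0 : F (Iio 0) = 0) (hG : Integrable (fun t : ℝ => t) G) {L : ℝ} (hL : 1 ≤ L) :
    ∃ G' : Measure ℝ, IsProbabilityMeasure G' ∧ Integrable (fun t : ℝ => t) G' ∧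
      ∫ t, t ∂G' ≤ ∫ t, t ∂G ∧
      ∀ y, G' (Ioi y) = min (G (Ioi y)) (ENNReal.ofReal L * F (Ioi y)) := by
  have hL0 : 0 ≤ L := zero_le_one.trans hL
  set f := minTailCDF G F L hL0 with hf
  have hbot : Tendsto f atBot (𝓝 0) := by
    have h : Tendsto f atBot (𝓝 (max 0 (1 - L * (1 - 0)))) :=
      (tendsto_cdf_atBot G).max (((tendsto_cdf_atBot F).const_sub 1).const_mul L |>.const_sub 1)
    rwa [max_eq_left (by linarith)] at h
  have htop : Tendsto f atTop (𝓝 1) := by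
    have h : Tendsto f atTop (𝓝 (max 1 (1 - L * (1 - 1)))) :=
      (tendsto_cdf_atTop G).max (((tendsto_cdf_atTop F).const_sub 1).const_mul L |>.const_sub 1)
    rwa [sub_self, mul_zero, sub_zero, max_self] at h
  have hprob : IsProbabilityMeasure f.measure := f.isProbabilityMeasure hbot htop
  have htail : ∀ y, f.measure (Ioi y) = min (G (Ioi y)) (ENNReal.ofReal L * F (Ioi y)) := by
    intro y
    rw [f.measure_Ioi htop, ← ofReal_measureReal (μ := G), ← ofReal_measureReal (μ := F),
      ← ENNReal.ofReal_mul hL0, ← ENNReal.ofReal_min, measureReal_Ioi_eq_cdf G,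
      measureReal_Ioi_eq_cdf F]
    congr 1
    change 1 - max (cdf G y) (1 - L * (1 - cdf F y)) = _
    rw [← min_sub_sub_left, sub_sub_cancel]
  have hle : ∀ y, f.measure (Ioi y) ≤ G (Ioi y) := fun y => (htail y).trans_le (min_le_left _ _)
  have heq : ∀ y < 0, f.measure (Iic y) = G (Iic y) := by
    intro y hy
    rw [← compl_Ioi, prob_compl_eq_one_sub measurableSet_Ioi,
      prob_compl_eq_one_sub measurableSet_Ioi, htail y, measure_Ioi_of_neg hF0 hy, mul_one,
      min_eq_left]
    exact prob_le_one.trans (by simpa using hL)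
  obtain ⟨h1, h2⟩ := integrable_and_integral_le_of_tail hG hle heq
  exact ⟨f.measure, hprob, h1, h2, htail⟩

end DominatingLaw

section IIDWalk

variable (G : Measure ℝ) [IsProbabilityMeasure G]

/-- A walk with independent steps is a modulated walk over a one-point state space, so the passage
decomposition covers it too. -/
theorem isModulated_infinitePi :
    IsModulated (Measure.infinitePi fun _ : ℕ => G) (Kernel.const Unit G) (fun _ _ => ())
      (fun n _ ω => ω n) where
  measurable_X n _ := measurable_const
  law n _ x := by
    rw [Kernel.const_apply]
    exact Measure.infinitePi_map_eval (fun _ : ℕ => G) n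
  indep := by
    have hind : iIndepFun (fun (i : ℕ) (ω : ℕ → ℝ) => ω i) (Measure.infinitePi fun _ : ℕ => G) :=
      iIndepFun_infinitePi (P := fun _ : ℕ => G) (X := fun _ t => t) fun i => measurable_id
    refine ⟨fun n => MeasurableSpace.comap (fun ω : ℕ → ℝ => ω n) inferInstance, fun n => ?_,
      fun n => ?_, ?_, ?_⟩
    · exact (measurable_pi_apply (n : ℕ)).comap_le
    · exact (comap_measurable (fun ω : ℕ → ℝ => ω n)).comp (@measurable_snd _ _ _
        (MeasurableSpace.comap (fun ω : ℕ → ℝ => ω n) inferInstance))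
    · exact (hind.precomp (g := ((↑) : ℕ+ → ℕ)) PNat.coe_injective)
    · have : (⨆ _ : ℕ+, MeasurableSpace.comap (fun _ : ℕ → ℝ => ()) inferInstance) = ⊥ := by
        simp [MeasurableSpace.comap_const]
      rw [this]
      exact indep_bot_right _

theorem hasDrift_infinitePi (hG : Integrable (fun t : ℝ => t) G) :
    HasDrift (Measure.infinitePi fun _ : ℕ => G) (fun _ _ => ()) (fun n (_ : Unit) ω => ω n)
      (-∫ t, t ∂G) := by
  have hmp : ∀ i : ℕ, MeasurePreserving (fun ω : ℕ → ℝ => ω i) (Measure.infinitePi fun _ => G) G :=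
    fun i => measurePreserving_eval_infinitePi (fun _ : ℕ => G) i
  have hind : iIndepFun (fun (i : ℕ) (ω : ℕ → ℝ) => ω i) (Measure.infinitePi fun _ : ℕ => G) :=
    iIndepFun_infinitePi (P := fun _ : ℕ => G) (X := fun _ t => t) fun i => measurable_id
  have hslln := strong_law_ae_real (μ := Measure.infinitePi fun _ : ℕ => G)
    (fun i ω => ω (i + 1)) ((hmp 1).integrable_comp_of_integrable hG)
    (fun i j hij => hind.indepFun (by lia))
    (fun i => ⟨(hmp _).aemeasurable, (hmp _).aemeasurable, by rw [(hmp _).map_eq, (hmp _).map_eq]⟩)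
  have hmean : ∫ ω, ω (0 + 1) ∂(Measure.infinitePi fun _ : ℕ => G) = ∫ t, t ∂G := by
    have := integral_map (hmp (0 + 1)).aemeasurable (f := fun t : ℝ => t)
      measurable_id.aestronglyMeasurable
    rw [(hmp (0 + 1)).map_eq] at this
    exact this.symm
  rw [hmean] at hslln
  filter_upwards [hslln] with ω hω
  rw [neg_neg]
  refine hω.congr fun n => ?_
  rw [walk, Finset.range_eq_Ico, Finset.sum_Ico_add' (fun i => ω i) 0 n 1]
  rfl

end IIDWalk

/-! ### Tail bounds for the supremum -/

section Core

variable {F Q ρ : Measure ℝ}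

/-- Only tails of `ρ` are controlled, so Fubini is used to turn the integral into `ρ`-measures of
sections. These are half-lines starting beyond `h`, where `ρ` may be replaced by `C Q`. -/
theorem lintegral_tail_le_prod [SFinite Q] [SFinite ρ] {C : ℝ≥0∞} {h : ℝ}
    (hρ : ∀ z, h ≤ z → ρ (Ioi z) ≤ C * Q (Ioi z)) (y : ℝ) :
    ∫⁻ s in Ioc h (y - h), Q (Ioi (y - s)) ∂ρ
      ≤ C * (Q.prod Q) {p | h < p.1 ∧ h < p.2 ∧ y < p.1 + p.2} := by
  set D : Set (ℝ × ℝ) := {p | h < p.1 ∧ h < p.2 ∧ y < p.1 + p.2} with hD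
  have hDm : MeasurableSet D :=
    (measurableSet_lt measurable_const measurable_fst).inter
      ((measurableSet_lt measurable_const measurable_snd).inter
        (measurableSet_lt measurable_const (measurable_fst.add measurable_snd)))
  have hsec : ∀ v, (fun s => (s, v)) ⁻¹' D = if h < v then Ioi (max h (y - v)) else ∅ := by
    intro v
    ext s
    split_ifs with hv
    · simp only [hD, mem_preimage, mem_ofPred_eq, mem_Ioi, max_lt_iff, hv, true_and]
      exact and_congr_right fun _ => ⟨fun hs => by linarith, fun hs => by linarith⟩
    · simp [hD, hv]
  calc ∫⁻ s in Ioc h (y - h), Q (Ioi (y - s)) ∂ρ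
      ≤ ∫⁻ s in Ioc h (y - h), Q (Prod.mk s ⁻¹' D) ∂ρ := by
        refine setLIntegral_mono (measurable_measure_prodMk_left hDm) fun s hs => ?_
        refine measure_mono fun v hv => ?_
        have hv' : y - s < v := hv
        have h1 : h < s := hs.1
        have h2 : s ≤ y - h := hs.2
        exact ⟨h1, by change h < v; linarith, by change y < s + v; linarith⟩
    _ ≤ ∫⁻ s, Q (Prod.mk s ⁻¹' D) ∂ρ := setLIntegral_le_lintegral _ _
    _ = ∫⁻ v, ρ ((fun s => (s, v)) ⁻¹' D) ∂Q := by
        rw [← Measure.prod_apply hDm, Measure.prod_apply_symm hDm]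
    _ ≤ ∫⁻ v, C * Q ((fun s => (s, v)) ⁻¹' D) ∂Q := by
        refine lintegral_mono fun v => ?_
        rw [hsec]
        split_ifs
        · exact hρ _ (le_max_left _ _)
        · simp
    _ = C * (Q.prod Q) D := by
        rw [lintegral_const_mul _ (measurable_measure_prodMk_right hDm),
          Measure.prod_apply_symm hDm]

/-- Positions below `h` cost only the total mass of `ρ` times the value at `y - h`; the intermediate
ones form a convolution with both parts large. -/
theorem lintegral_exceed_le_add {m : ℝ → ℝ≥0∞} (hm : Antitone m) {h y : ℝ} (hh : 0 ≤ h)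
    (hy : 2 * h ≤ y) {R : ℝ≥0∞} (hR : ∀ z ∈ Icc 0 y, m z ≤ R * Q (Ioi z)) :
    ∫⁻ s in Iic (y - h), m (y - s) ∂ρ
      ≤ R * Q (Ioi (y - h)) * ρ univ + R * ∫⁻ s in Ioc h (y - h), Q (Ioi (y - s)) ∂ρ := by
  have hQm : Measurable fun s => Q (Ioi (y - s)) :=
    (measurable_measure_Ioi Q).comp (measurable_const.sub measurable_id)
  rw [← Iic_union_Ioc_eq_Iic (show h ≤ y - h by linarith)]
  refine (lintegral_union_le _ _ _).trans (add_le_add ?_ ?_)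
  · calc ∫⁻ s in Iic h, m (y - s) ∂ρ ≤ ∫⁻ s in Iic h, R * Q (Ioi (y - h)) ∂ρ := by
          refine setLIntegral_mono measurable_const fun s hs => ?_
          have hs' : s ≤ h := hs
          exact (hm (by linarith)).trans (hR (y - h) ⟨by linarith, by linarith⟩)
      _ ≤ R * Q (Ioi (y - h)) * ρ univ := by
          rw [setLIntegral_const]
          gcongr
          exact subset_univ _
  · rw [← lintegral_const_mul _ hQm]
    refine setLIntegral_mono (hQm.const_mul _) fun s hs => ?_
    have h1 : h < s := hs.1
    have h2 : s ≤ y - h := hs.2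
    exact hR _ ⟨by linarith, by linarith⟩

/-- After the passage over the barrier, exceeding a high level `y` from a position far below it is
unlikely in comparison with the tail of the integrated law. -/
theorem IsIntegratedLaw.eventually_lintegral_exceed_le (hQ : IsIntegratedLaw F Q)
    {m : ℝ → ℝ≥0∞} (hm : Antitone m) [SFinite ρ] {C δ ε : ℝ} (hδ : 0 ≤ δ) (hε : 0 < ε)
    (hC : 0 ≤ C) (hρδ : ρ univ ≤ ENNReal.ofReal δ)
    (hρ : ∀ᶠ z in atTop, ρ (Ioi z) ≤ ENNReal.ofReal C * Q (Ioi z)) :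
    ∃ h : ℝ, ∀ᶠ y in atTop, ∀ R : ℝ≥0∞, (∀ z ∈ Icc 0 y, m z ≤ R * Q (Ioi z)) →
      ∫⁻ s in Iic (y - h), m (y - s) ∂ρ ≤ R * ENNReal.ofReal (2 * δ + ε) * Q (Ioi y) := by
  have := hQ.isProb
  obtain ⟨z₀, hz₀⟩ := eventually_atTop.1 hρ
  obtain ⟨h, hb, hh⟩ := ((hQ.both_large (ε / (C + 1)) (by positivity)).and
    (eventually_ge_atTop (max z₀ 0))).exists
  have hh0 : 0 ≤ h := (le_max_right _ _).trans hh
  -- Neither `h` nor the range of `y` depends on `R`, which may therefore vary with `y`; the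
  -- bootstrap relies on this.
  refine ⟨h, ?_⟩
  filter_upwards [hb, hQ.long h 2 one_lt_two, eventually_ge_atTop (2 * h)] with y h1 h2 h3 R hR
  refine (lintegral_exceed_le_add hm hh0 h3 hR).trans ?_
  have h4 : R * Q (Ioi (y - h)) * ρ univ ≤ R * ENNReal.ofReal (2 * δ) * Q (Ioi y) := by
    calc R * Q (Ioi (y - h)) * ρ univ
        ≤ R * (ENNReal.ofReal 2 * Q (Ioi y)) * ENNReal.ofReal δ := by gcongr
      _ = R * ENNReal.ofReal (2 * δ) * Q (Ioi y) := by
          rw [ENNReal.ofReal_mul zero_le_two]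
          ring
  have h5 : R * ∫⁻ s in Ioc h (y - h), Q (Ioi (y - s)) ∂ρ
      ≤ R * ENNReal.ofReal ε * Q (Ioi y) := by
    rw [mul_assoc]
    gcongr
    calc _ ≤ ENNReal.ofReal C * (Q.prod Q) {p | h < p.1 ∧ h < p.2 ∧ y < p.1 + p.2} :=
          lintegral_tail_le_prod (fun z hz => hz₀ z (((le_max_left _ _).trans hh).trans hz)) y
      _ ≤ ENNReal.ofReal C * (ENNReal.ofReal (ε / (C + 1)) * Q (Ioi y)) := by gcongr
      _ ≤ _ := by
          rw [← mul_assoc, ← ENNReal.ofReal_mul hC]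
          gcongr
          rw [mul_div_assoc', div_le_iff₀ (by positivity)]
          nlinarith
  calc _ ≤ R * ENNReal.ofReal (2 * δ) * Q (Ioi y) + R * ENNReal.ofReal ε * Q (Ioi y) :=
        add_le_add h4 h5
    _ = _ := by
        rw [ENNReal.ofReal_add (by positivity) hε.le]
        ring

end Core

/-! ### Self-improving bound for the dominating walk. -/

section Bootstrap

variable {F Q : Measure ℝ}

/-- The supremum `R` of the ratio over `[0, y]` is finite from the outset, because `m ≤ 1` and the
tail is positive at `y`. The hypothesis gives `R ≤ A + 1 / Q(Ioi y₀) + R / 2`, and `R / 2` can be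
cancelled; the resulting bound does not depend on `y`. -/
theorem le_mul_of_forall_le_add_half {m : ℝ → ℝ≥0∞} (hm1 : ∀ z, m z ≤ 1)
    (hQ : IsIntegratedLaw F Q) {A : ℝ≥0∞} {y₀ : ℝ}
    (h : ∀ y, y₀ ≤ y → ∀ R : ℝ≥0∞, (∀ z ∈ Icc 0 y, m z ≤ R * Q (Ioi z)) →
      m y ≤ (A + R / 2) * Q (Ioi y)) {y : ℝ} (hy : 0 ≤ y) :
    m y ≤ 2 * (A + (Q (Ioi y₀))⁻¹) * Q (Ioi y) := by
  have := hQ.isProb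
  have hne : ∀ z, Q (Ioi z) ≠ 0 := fun z => (hQ.pos z).ne'
  have htop : ∀ z, Q (Ioi z) ≠ ∞ := fun z => measure_ne_top _ _
  set R : ℝ≥0∞ := ⨆ z ∈ Icc 0 y, m z / Q (Ioi z) with hR
  have hRle : ∀ z ∈ Icc 0 y, m z ≤ R * Q (Ioi z) := fun z hz =>
    (ENNReal.div_le_iff (hne z) (htop z)).1 (le_iSup₂ (f := fun z _ => m z / Q (Ioi z)) z hz)
  have hRfin : R ≠ ∞ := by
    refine ((iSup₂_le fun z hz => ?_).trans_lt (ENNReal.inv_lt_top.2 (hQ.pos y))).ne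
    calc m z / Q (Ioi z) ≤ 1 / Q (Ioi y) :=
          ENNReal.div_le_div (hm1 z) (measure_mono (Ioi_subset_Ioi hz.2))
      _ = _ := one_div _
  have hstep : R ≤ A + (Q (Ioi y₀))⁻¹ + R / 2 := by
    refine iSup₂_le fun z hz => ?_
    rcases le_or_gt y₀ z with hz' | hz'
    · rw [ENNReal.div_le_iff (hne z) (htop z)]
      refine (h z hz' R fun w hw => hRle w ⟨hw.1, hw.2.trans hz.2⟩).trans ?_
      gcongr
      exact le_self_add
    · calc m z / Q (Ioi z) ≤ 1 / Q (Ioi y₀) :=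
            ENNReal.div_le_div (hm1 z) (measure_mono (Ioi_subset_Ioi hz'.le))
        _ = (Q (Ioi y₀))⁻¹ := one_div _
        _ ≤ _ := le_add_self.trans le_self_add
  have hhalf : R / 2 ≤ A + (Q (Ioi y₀))⁻¹ := by
    have hfin : R / 2 ≠ ∞ := (ENNReal.div_lt_top hRfin two_ne_zero).ne
    nth_rewrite 1 [← ENNReal.add_halves R] at hstep
    exact (ENNReal.add_le_add_iff_right hfin).1 hstep
  refine (hRle y ⟨hy, le_rfl⟩).trans ?_
  gcongr
  calc R = 2 * (R / 2) := by rw [two_mul, ENNReal.add_halves]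
    _ ≤ _ := by gcongr

variable [IsProbabilityMeasure F] {L : ℝ}

theorem IsIntegratedLaw.eventually_jumpSum_le_mul {E Ω : Type*} [MeasurableSpace E]
    [MeasurableSpace Ω] {Pr : Measure Ω} [IsProbabilityMeasure Pr] {P : Kernel E ℝ}
    {X : ℕ → Ω → E} {B : Set E} (hQ : IsIntegratedLaw F Q) (hF : Integrable (fun t : ℝ => t) F)
    (hL : ∀ x y, P x (Ioi y) ≤ ENNReal.ofReal L * F (Ioi y)) (hL0 : 0 ≤ L) {α : ℝ} (hα : 0 < α)
    (K : ℝ) :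
    ∀ᶠ z in atTop, jumpSum Pr P X B α (z - K) ≤ ENNReal.ofReal (2 * L / α) * Q (Ioi z) := by
  filter_upwards [hQ.intTail_long hF K one_lt_two, hQ.eventually_eq hF] with z h1 h2
  calc jumpSum Pr P X B α (z - K) ≤ ENNReal.ofReal (L / α) * intTail F (z - K) :=
        jumpSum_le_intTail hL hα _
    _ ≤ ENNReal.ofReal (L / α) * (ENNReal.ofReal 2 * intTail F z) := by gcongr
    _ = _ := by
        rw [h2, ← mul_assoc, ← ENNReal.ofReal_mul (by positivity)]
        congr 2
        ring

/-- A random walk with negative drift whose step law has a tail dominated by that of `F` exceeds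
high levels with probability at most a multiple of the integrated tail of `F`. -/
theorem IsIntegratedLaw.exists_exceedProb_le (hQ : IsIntegratedLaw F Q)
    (hF : Integrable (fun t : ℝ => t) F) {G : Measure ℝ} [IsProbabilityMeasure G]
    (hG : Integrable (fun t : ℝ => t) G) (hneg : ∫ t, t ∂G < 0) (hL0 : 0 ≤ L)
    (hL : ∀ y, G (Ioi y) ≤ ENNReal.ofReal L * F (Ioi y)) :
    ∃ R : ℝ, 0 < R ∧ ∀ y, 0 ≤ y → exceedProb G y ≤ ENNReal.ofReal R * Q (Ioi y) := by
  have := hQ.isProb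
  obtain ⟨𝓗, h⟩ := (isModulated_infinitePi G).exists_isHistory
  have hdrift := hasDrift_infinitePi G hG
  set b : ℝ := -∫ t, t ∂G with hb
  have hb0 : 0 < b := by linarith
  have hL' : ∀ (x : Unit) (y : ℝ), Kernel.const Unit G x (Ioi y) ≤ ENNReal.ofReal L * F (Ioi y) :=
    fun x y => by rw [Kernel.const_apply]; exact hL y
  obtain ⟨K, ρ, hρ1, hρ2, hρ3⟩ := h.exists_passage_law (G := G)
    (fun x y => by rw [Kernel.const_apply]) hdrift (half_pos hb0) (half_lt_self hb0)
    (δ := ENNReal.ofReal (1 / 8)) (by simp)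
  have : IsFiniteMeasure ρ := ⟨hρ1.trans_lt ENNReal.ofReal_lt_top⟩
  set C : ℝ := 2 * L / (b / 2) with hC
  have hC0 : 0 ≤ C := by positivity
  have hρtail : ∀ᶠ z in atTop, ρ (Ioi z) ≤ ENNReal.ofReal C * Q (Ioi z) := by
    filter_upwards [hQ.eventually_jumpSum_le_mul (Pr := Measure.infinitePi fun _ : ℕ => G)
      (X := fun _ _ => ()) (B := univ) hF hL' hL0 (half_pos hb0) K] with z hz
    exact (hρ2 z).trans hz
  -- The constants are such that `2 · 1/8 + 1/4 = 1/2`, the contraction factor required by the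
  -- bootstrap.
  obtain ⟨v, hv⟩ := hQ.eventually_lintegral_exceed_le (exceedProb_antitone (G := G))
    (δ := 1 / 8) (ε := 1 / 4) (by norm_num) (by norm_num) hC0 hρ1 hρtail
  have hev : ∀ᶠ y in atTop, ∀ R : ℝ≥0∞, (∀ z ∈ Icc 0 y, exceedProb G z ≤ R * Q (Ioi z)) →
      exceedProb G y ≤ (ENNReal.ofReal (C * 2) + R / 2) * Q (Ioi y) := by
    filter_upwards [hv, hQ.long v 2 one_lt_two, eventually_ge_atTop K,
      (tendsto_atTop_add_const_right atTop (-v) tendsto_id).eventually hρtail]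
      with y h1 h2 h3 h4 R hR
    rw [id, ← sub_eq_add_neg] at h4
    calc exceedProb G y ≤ _ := h.exceedProb_le (fun x => Kernel.const_apply _ _) y
      _ ≤ _ := hρ3 (y - v) y h3
      _ ≤ ENNReal.ofReal C * (ENNReal.ofReal 2 * Q (Ioi y))
          + R * ENNReal.ofReal (2 * (1 / 8) + 1 / 4) * Q (Ioi y) := by
          refine add_le_add (h4.trans ?_) (h1 R hR)
          gcongr
      _ = _ := by
          have h5 : ENNReal.ofReal (2 * (1 / 8) + 1 / 4) = 2⁻¹ := by
            rw [← ENNReal.ofReal_ofNat 2, ← ENNReal.ofReal_inv_of_pos two_pos]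
            norm_num
          rw [add_mul, ENNReal.ofReal_mul hC0, h5, ← div_eq_mul_inv, mul_assoc]
  obtain ⟨y₀, hy₀⟩ := eventually_atTop.1 hev
  set A : ℝ≥0∞ := 2 * (ENNReal.ofReal (C * 2) + (Q (Ioi y₀))⁻¹) with hA
  have hAfin : A ≠ ∞ := ENNReal.mul_ne_top (by simp)
    (ENNReal.add_ne_top.2 ⟨ENNReal.ofReal_ne_top, (ENNReal.inv_lt_top.2 (hQ.pos _)).ne⟩)
  refine ⟨A.toReal + 1, by positivity, fun y hy => ?_⟩
  refine (le_mul_of_forall_le_add_half exceedProb_le_one hQ hy₀ hy).trans ?_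
  gcongr
  rw [← hA, ENNReal.le_ofReal_iff_toReal_le hAfin (by positivity)]
  linarith

end Bootstrap

/-! ### Asymptotics of the supremum -/

/-- The event that the walk has stayed below `K` up to time `n` and is not far below its drift. -/
def typicalPast {E Ω : Type*} (X : ℕ → Ω → E) (ξ : ℕ → E → Ω → ℝ) (K β : ℝ) (n : ℕ) : Set Ω :=
  {ω | -K - β * n ≤ walk X ξ n ω} ∩ ⋂ k ∈ Finset.range (n + 1), {ω | walk X ξ k ω ≤ K}

section Supremum

variable {E Ω : Type*} {X : ℕ → Ω → E} {ξ : ℕ → E → Ω → ℝ} {B : Set E}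

theorem lt_walkSup_iff {y : ℝ} {ω : Ω} :
    (y : EReal) < walkSup X ξ ω ↔ ∃ k, y < walk X ξ k ω := by
  simp [walkSup, lt_iSup_iff]

/-- For levels `y ≥ 0`, the event `{M > y, X_{μ(y)} ∈ B}` decomposed by the value of `μ(y)`. -/
theorem setOf_lt_walkSup_eq {y : ℝ} (hy : 0 ≤ y) (B : Set E) :
    {ω | (y : EReal) < walkSup X ξ ω ∧ X (passageTime X ξ y ω) ω ∈ B}
      = ⋃ n, firstPassage X ξ y 0 (n + 1) ∩ X (n + 1) ⁻¹' B := by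
  ext ω
  simp only [mem_ofPred_eq, mem_iUnion, mem_inter_iff, mem_preimage, lt_walkSup_iff, firstPassage,
    zero_mul, sub_zero]
  constructor
  · rintro ⟨⟨k, hk⟩, hB⟩
    have hk1 : 1 ≤ k := by
      rcases Nat.eq_zero_or_pos k with rfl | h
      · rw [walk_zero] at hk
        linarith
      · exact h
    have hne : {n : ℕ | 1 ≤ n ∧ y < walk X ξ n ω}.Nonempty := ⟨k, hk1, hk⟩
    have hmem := Nat.sInf_mem hne
    obtain ⟨n, hn⟩ : ∃ n, passageTime X ξ y ω = n + 1 :=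
      Nat.exists_eq_succ_of_ne_zero (Nat.one_le_iff_ne_zero.1 hmem.1)
    rw [hn] at hB
    change 1 ≤ passageTime X ξ y ω ∧ y < walk X ξ (passageTime X ξ y ω) ω at hmem
    rw [hn] at hmem
    refine ⟨n, ⟨hmem.2, fun j hj => ?_⟩, hB⟩
    rcases Nat.eq_zero_or_pos j with rfl | h
    · rwa [walk_zero]
    · by_contra hlt
      have : passageTime X ξ y ω ≤ j := Nat.sInf_le ⟨h, not_le.1 hlt⟩
      lia
  · rintro ⟨n, ⟨h1, h2⟩, hB⟩
    have : passageTime X ξ y ω = n + 1 := by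
      refine le_antisymm (Nat.sInf_le ⟨by lia, h1⟩) ?_
      refine le_csInf ⟨n + 1, by lia, h1⟩ fun j hj => ?_
      by_contra hlt
      exact absurd hj.2 (not_lt.2 (h2 j (by lia)))
    rw [this]
    exact ⟨⟨n + 1, h1⟩, hB⟩

theorem pairwise_disjoint_firstPassage (K α : ℝ) (B : Set E) :
    Pairwise (Function.onFun Disjoint
      fun n => firstPassage X ξ K α (n + 1) ∩ X (n + 1) ⁻¹' B) := by
  intro i j hij
  refine Set.disjoint_left.2 fun ω hi hj => ?_
  rcases lt_or_gt_of_ne hij with hlt | hlt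
  · exact absurd hi.1.1 (not_lt.2 (hj.1.2 (i + 1) (by lia)))
  · exact absurd hj.1.1 (not_lt.2 (hi.1.2 (j + 1) (by lia)))

variable [MeasurableSpace E] [MeasurableSpace Ω] {Pr : Measure Ω} {P : Kernel E ℝ}
  {𝓗 : ℕ → MeasurableSpace Ω}

theorem IsHistory.measurableSet_firstPassage_inter (h : IsHistory Pr P X ξ 𝓗)
    (hB : MeasurableSet B) (K α : ℝ) (n : ℕ) :
    MeasurableSet (firstPassage X ξ K α (n + 1) ∩ X (n + 1) ⁻¹' B) :=
  (h.le _ _ (h.measurableSet_firstPassage K α (n + 1))).inter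
    (((h.measurable_X 0 (n + 1) (by lia)).mono (h.le _) le_rfl) hB)

theorem IsHistory.measurableSet_lt_walkSup (h : IsHistory Pr P X ξ 𝓗) (hB : MeasurableSet B)
    {y : ℝ} (hy : 0 ≤ y) :
    MeasurableSet {ω | (y : EReal) < walkSup X ξ ω ∧ X (passageTime X ξ y ω) ω ∈ B} := by
  rw [setOf_lt_walkSup_eq hy]
  exact MeasurableSet.iUnion fun n => h.measurableSet_firstPassage_inter hB y 0 n

variable {F : Measure ℝ} {L a : ℝ}

/-- After a typical past the walk has not exceeded `K ≤ y` and is at least `-K - β n`, so this jump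
makes the passage occur exactly at time `n + 1`. After an atypical past the jump probability is
still at most `L F̄`, uniformly in the state, so the error is summable in `n` with the small factor
`δ`. -/
theorem IsHistory.jumpProb_le_add (h : IsHistory Pr P X ξ 𝓗)
    (hL : ∀ x y, P x (Ioi y) ≤ ENNReal.ofReal L * F (Ioi y)) (hB : MeasurableSet B) {K β y : ℝ}
    (hβ : 0 ≤ β) (hy : K ≤ y) {δ : ℝ≥0∞}
    (hbad : ∀ n, Pr (typicalPast X ξ K β n)ᶜ ≤ δ) (n : ℕ) :
    jumpProb Pr P X B (n + 1) (y + K + β * (n + 1))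
      ≤ Pr (firstPassage X ξ y 0 (n + 1) ∩ X (n + 1) ⁻¹' B)
        + δ * (ENNReal.ofReal L * F (Ioi (y + K + β * (n + 1)))) := by
  set z : ℝ := y + K + β * (n + 1) with hz
  have hD : MeasurableSet[𝓗 n] (typicalPast X ξ K β n) := by
    refine (measurableSet_le measurable_const (h.measurable_walk le_rfl)).inter ?_
    refine Finset.measurableSet_biInter _ fun k hk => ?_
    exact measurableSet_le (h.measurable_walk (Nat.lt_succ_iff.1 (Finset.mem_range.1 hk)))
      measurable_const
  have hXB : MeasurableSet[𝓗 n] (X (n + 1) ⁻¹' B) := h.measurable_X n (n + 1) (by lia) hB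
  rw [jumpProb, ← lintegral_inter_add_sdiff _ _ (h.le n _ hD), inter_comm]
  refine add_le_add ?_ ?_
  · rw [← h.measure_inter_incr_gt n (hD.inter hXB)]
    refine measure_mono ?_
    rintro ω ⟨⟨⟨h1, h2⟩, h3⟩, h4⟩
    refine ⟨⟨?_, fun k hk => ?_⟩, h3⟩
    · have h1' : -K - β * n ≤ walk X ξ n ω := h1
      have h4' : z < ξ (n + 1) (X (n + 1) ω) ω := h4
      rw [walk_succ]
      linarith
    · have : walk X ξ k ω ≤ K := mem_iInter₂.1 h2 k (Finset.mem_range.2 hk)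
      linarith
  · calc ∫⁻ ω in X (n + 1) ⁻¹' B \ typicalPast X ξ K β n, P (X (n + 1) ω) (Ioi z) ∂Pr
        ≤ ∫⁻ ω in (typicalPast X ξ K β n)ᶜ, P (X (n + 1) ω) (Ioi z) ∂Pr :=
          lintegral_mono_set fun ω hω => hω.2
      _ ≤ ∫⁻ ω in (typicalPast X ξ K β n)ᶜ, ENNReal.ofReal L * F (Ioi z) ∂Pr :=
          lintegral_mono fun ω => hL _ _
      _ ≤ _ := by
          rw [setLIntegral_const, mul_comm]
          gcongr
          exact hbad n

variable [IsProbabilityMeasure Pr]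

theorem IsHistory.exists_typicalPast (h : IsHistory Pr P X ξ 𝓗) (hC2 : HasDrift Pr X ξ a)
    (ha : 0 < a) {β δ : ℝ} (hβ : a < β) (hδ : 0 < δ) :
    ∃ K : ℝ, 0 ≤ K ∧ ∀ n, Pr (typicalPast X ξ K β n)ᶜ ≤ ENNReal.ofReal δ := by
  have hδ2 : 0 < ENNReal.ofReal (δ / 2) := by simpa using hδ
  -- A barrier of slope `0`: it bounds the whole supremum of the walk.
  obtain ⟨K₁, hK₁0, hK₁⟩ := h.exists_barrier hC2 ha hδ2
  obtain ⟨K₂, -, hK₂⟩ := h.exists_lower_barrier hC2 hβ hδ2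
  refine ⟨max K₁ K₂, hK₁0.trans (le_max_left _ _), fun n => ?_⟩
  calc Pr (typicalPast X ξ (max K₁ K₂) β n)ᶜ
      ≤ Pr ({ω | ∃ n : ℕ, K₁ - 0 * n < walk X ξ n ω}
        ∪ {ω | ∃ n : ℕ, walk X ξ n ω < -K₂ - β * n}) := by
        refine measure_mono fun ω hω => ?_
        by_contra hgood
        rw [mem_union, not_or] at hgood
        obtain ⟨h1, h2⟩ := hgood
        simp only [mem_ofPred_eq, not_exists, not_lt, zero_mul, sub_zero] at h1 h2
        refine hω ⟨?_, mem_iInter₂.2 fun k _ => (h1 k).trans (le_max_left _ _)⟩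
        have h3 := h2 n
        have h4 := le_max_right K₁ K₂
        change -max K₁ K₂ - β * n ≤ walk X ξ n ω
        linarith
    _ ≤ ENNReal.ofReal (δ / 2) + ENNReal.ofReal (δ / 2) :=
        (measure_union_le _ _).trans (add_le_add hK₁ hK₂)
    _ = ENNReal.ofReal δ := by
        rw [← ENNReal.ofReal_add (by positivity) (by positivity), add_halves]

variable [IsMarkovKernel P] [IsProbabilityMeasure F] {Q : Measure ℝ} {c : E → ℝ}
  {π : Measure E} [IsProbabilityMeasure π] {d : ℕ}

theorem IsHistory.eventually_measure_exceed_le (h : IsHistory Pr P X ξ 𝓗)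
    (hQ : IsIntegratedLaw F Q) (hF : Integrable (fun t : ℝ => t) F)
    (hL : ∀ x y, P x (Ioi y) ≤ ENNReal.ofReal L * F (Ioi y)) (hL0 : 0 ≤ L)
    (htail : ∀ x, (fun y => tail (P x) y - c x * tail F y) =o[atTop] tail F)
    (hc : ∀ x, 0 ≤ c x) (hd : 0 < d) (hC1 : ConvergesInMean Pr X d π) (ha : 0 < a)
    (hC2 : HasDrift Pr X ξ a) {G : Measure ℝ} [IsProbabilityMeasure G]
    (hG : Integrable (fun t : ℝ => t) G) (hneg : ∫ t, t ∂G < 0)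
    (hGL : ∀ y, G (Ioi y) ≤ ENNReal.ofReal L * F (Ioi y))
    (hPG : ∀ x y, P x (Ioi y) ≤ G (Ioi y)) {ε : ℝ} (hε : 0 < ε) :
    ∀ᶠ y in atTop, Pr {ω | ∃ k, y < walk X ξ k ω}
      ≤ ENNReal.ofReal ((∫ x, c x ∂π) / a + ε) * intTail F y := by
  have := hQ.isProb
  set C := ∫ x, c x ∂π with hC
  have hC0 : 0 ≤ C := integral_nonneg hc
  obtain ⟨α, hα⟩ : ∃ α, (C / α < C / a + ε / 4 ∧ 0 < α) ∧ α < a := by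
    have hcont : Tendsto (fun α => C / α) (𝓝[<] a) (𝓝 (C / a)) :=
      (tendsto_const_nhds.div tendsto_id ha.ne').mono_left nhdsWithin_le_nhds
    exact (((hcont.eventually (gt_mem_nhds (by linarith))).and
      ((eventually_gt_nhds ha).filter_mono nhdsWithin_le_nhds)).and self_mem_nhdsWithin).exists
  obtain ⟨⟨hα1, hα0⟩, hαa⟩ := hα
  obtain ⟨R, hR0, hR⟩ := hQ.exists_exceedProb_le hF hG hneg hL0 hGL
  -- Makes the climb after the crossing cost `R (2δ + 2δ) = ε/2`; the other half of `ε` is shared by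
  -- the choice of `α` and the asymptotics of the jump sum. The order matters: `R` belongs to the
  -- dominating walk alone and is fixed before the barrier.
  set δ : ℝ := ε / (8 * R) with hδ
  have hδ0 : 0 < δ := by positivity
  obtain ⟨K, ρ, hρ1, hρ2, hρ3⟩ := h.exists_passage_law hPG hC2 hα0 hαa
    (δ := ENNReal.ofReal δ) (by simpa using hδ0)
  have : IsFiniteMeasure ρ := ⟨hρ1.trans_lt ENNReal.ofReal_lt_top⟩
  have hρtail : ∀ᶠ z in atTop, ρ (Ioi z) ≤ ENNReal.ofReal (2 * L / α) * Q (Ioi z) := by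
    filter_upwards [hQ.eventually_jumpSum_le_mul (Pr := Pr) (X := X) (B := univ) hF hL hL0 hα0 K]
      with z hz
    exact (hρ2 z).trans hz
  obtain ⟨v, hv⟩ := hQ.eventually_lintegral_exceed_le (exceedProb_antitone (G := G))
    (δ := δ) (ε := 2 * δ) hδ0.le (by positivity) (by positivity) hρ1 hρtail
  filter_upwards [hv, eventually_ge_atTop K, hQ.eventually_eq hF, eventually_jumpSum_le (π := π)
    (B := univ) hQ hF (fun n hn => (h.measurable_X 0 n hn).mono (h.le 0) le_rfl) MeasurableSet.univ
    hL hL0 htail hc hd hC1 hα0 (v + K) (show 0 < ε / 4 by positivity)] with y h1 h2 h3 h4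
  rw [setIntegral_univ, ← hC, ← sub_sub] at h4
  calc _ ≤ _ := hρ3 (y - v) y h2
    _ ≤ ENNReal.ofReal (C / α + ε / 4) * intTail F y
        + ENNReal.ofReal R * ENNReal.ofReal (2 * δ + 2 * δ) * intTail F y := by
        refine add_le_add ((hρ2 _).trans h4) ?_
        rw [← h3]
        exact h1 _ fun z hz => hR z hz.1
    _ = ENNReal.ofReal (C / α + ε / 4 + R * (2 * δ + 2 * δ)) * intTail F y := by
        rw [← ENNReal.ofReal_mul hR0.le, ← add_mul, ← ENNReal.ofReal_add (by positivity)
          (by positivity)]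
    _ ≤ _ := by
        gcongr ENNReal.ofReal ?_ * _
        have : R * (2 * δ + 2 * δ) = ε / 2 := by
          rw [hδ]
          field_simp
          ring
        linarith

theorem IsHistory.eventually_le_measure (h : IsHistory Pr P X ξ 𝓗)
    (hQ : IsIntegratedLaw F Q) (hF : Integrable (fun t : ℝ => t) F)
    (hL : ∀ x y, P x (Ioi y) ≤ ENNReal.ofReal L * F (Ioi y)) (hL0 : 0 ≤ L)
    (htail : ∀ x, (fun y => tail (P x) y - c x * tail F y) =o[atTop] tail F)
    (hd : 0 < d) (hC1 : ConvergesInMean Pr X d π) (ha : 0 < a)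
    (hC2 : HasDrift Pr X ξ a) (hB : MeasurableSet B) {ε : ℝ} (hε : 0 < ε) :
    ∀ᶠ y : ℝ in atTop, ENNReal.ofReal ((∫ x in B, c x ∂π) / a - ε) * intTail F y
      ≤ Pr {ω | (y : EReal) < walkSup X ξ ω ∧ X (passageTime X ξ y ω) ω ∈ B} := by
  set C := ∫ x in B, c x ∂π with hC
  rcases le_or_gt (C / a - ε) 0 with hneg | hpos
  · refine Eventually.of_forall fun y => ?_
    rw [ENNReal.ofReal_of_nonpos hneg, zero_mul]
    exact zero_le
  obtain ⟨β, hβ1, hβa⟩ : ∃ β, C / a - ε / 3 < C / β ∧ a < β := by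
    have hcont : Tendsto (fun β => C / β) (𝓝[>] a) (𝓝 (C / a)) :=
      (tendsto_const_nhds.div tendsto_id ha.ne').mono_left nhdsWithin_le_nhds
    exact ((hcont.eventually (lt_mem_nhds (by linarith))).and self_mem_nhdsWithin).exists
  have hβ0 : 0 < β := ha.trans hβa
  -- Atypical pasts contribute at most `δ L / β ≤ ε/3` times the integrated tail; the other thirds
  -- go to replacing `a` by `β` and to the jump sum.
  set δ : ℝ := ε / 3 * β / (L + 1) with hδ
  obtain ⟨K, hK0, hK⟩ := h.exists_typicalPast hC2 ha hβa (show 0 < δ by positivity)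
  filter_upwards [eventually_ge_atTop K, eventually_le_jumpSum (π := π) hQ hF
    (fun n hn => (h.measurable_X 0 n hn).mono (h.le 0) le_rfl) hB hL hL0 htail hd hC1 hβ0 K
    (show 0 < ε / 3 by positivity)] with y h1 h2
  have hsum : jumpSum Pr P X B β (y + K)
      ≤ Pr {ω | (y : EReal) < walkSup X ξ ω ∧ X (passageTime X ξ y ω) ω ∈ B}
        + ENNReal.ofReal (ε / 3) * intTail F y := by
    rw [setOf_lt_walkSup_eq (hK0.trans h1),
      measure_iUnion (pairwise_disjoint_firstPassage y 0 B)
        fun n => h.measurableSet_firstPassage_inter hB y 0 n]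
    refine (ENNReal.tsum_le_tsum fun n => h.jumpProb_le_add hL hB hβ0.le h1 hK n).trans ?_
    rw [ENNReal.tsum_add]
    refine add_le_add_right ?_ _
    calc ∑' n : ℕ, ENNReal.ofReal δ * (ENNReal.ofReal L * F (Ioi (y + K + β * (n + 1))))
        = ENNReal.ofReal (δ * L / β)
          * (ENNReal.ofReal β * ∑' n : ℕ, F (Ioi (y + K + β * (n + 1)))) := by
          rw [ENNReal.tsum_mul_left, ENNReal.tsum_mul_left, ← mul_assoc, ← mul_assoc,
            ← ENNReal.ofReal_mul (by positivity), ← ENNReal.ofReal_mul (by positivity),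
            div_mul_cancel₀ _ hβ0.ne']
      _ ≤ ENNReal.ofReal (ε / 3) * intTail F y := by
          refine mul_le_mul' (ENNReal.ofReal_le_ofReal ?_)
            ((tsum_measure_Ioi_le F hβ0 _).trans (intTail_antitone F (by linarith)))
          rw [hδ, div_mul_eq_mul_div, div_div, div_le_iff₀ (by positivity)]
          have : 0 < ε / 3 * β := by positivity
          nlinarith
  have hfin : ENNReal.ofReal (ε / 3) * intTail F y ≠ ∞ :=
    ENNReal.mul_ne_top ENNReal.ofReal_ne_top (intTail_ne_top hF y)
  refine (ENNReal.add_le_add_iff_right hfin).1 (le_trans ?_ (h2.trans hsum))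
  rw [← add_mul, ← ENNReal.ofReal_add hpos.le (by positivity)]
  gcongr ENNReal.ofReal ?_ * _
  linarith

end Supremum

/-! ### Consequences of the tail hypotheses, and the final squeeze. -/

section Hypotheses

variable {E : Type*} [MeasurableSpace E] {P : Kernel E ℝ} {F : Measure ℝ} [IsProbabilityMeasure F]

/-- Raising the constant to at least `1` extends the domination to negative levels, where `F̄ = 1`.
-/
theorem exists_measure_tail_le [IsMarkovKernel P] (hF0 : F (Iio 0) = 0)
    (hcomp : ∃ L : ℝ, ∀ x, ∀ y, 0 ≤ y → tail (P x) y ≤ L * tail F y) :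
    ∃ L : ℝ, 1 ≤ L ∧ ∀ x y, P x (Ioi y) ≤ ENNReal.ofReal L * F (Ioi y) := by
  obtain ⟨L, hL⟩ := hcomp
  refine ⟨max L 1, le_max_right _ _, fun x y => ?_⟩
  rcases lt_or_ge y 0 with hy | hy
  · rw [measure_Ioi_of_neg hF0 hy, mul_one]
    exact prob_le_one.trans (by simp)
  · refine measure_le_ofReal_mul_of_div_le (zero_le_one.trans (le_max_right _ _)) ?_
    refine (hL x y hy).trans ?_
    have : 0 ≤ tail F y := measureReal_nonneg
    change L * tail F y ≤ max L 1 * tail F y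
    gcongr
    exact le_max_left _ _

theorem integrable_tail_constant {c : E → ℝ} {L : ℝ} (hc_meas : Measurable c)
    (hc : ∀ x, 0 ≤ c x) (hL : ∀ x y, P x (Ioi y) ≤ ENNReal.ofReal L * F (Ioi y)) (hL0 : 0 ≤ L)
    (hFpos : ∀ z, 0 < F (Ioi z))
    (htail : ∀ x, (fun y => tail (P x) y - c x * tail F y) =o[atTop] tail F)
    (π : Measure E) [IsProbabilityMeasure π] : Integrable c π := by
  refine Integrable.of_bound hc_meas.aestronglyMeasurable L (Eventually.of_forall fun x => ?_)
  rw [Real.norm_of_nonneg (hc x)]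
  exact le_of_tendsto' (tendsto_tail_div hFpos (htail x)) fun z => tail_div_le hL hL0 hFpos x z

end Hypotheses

/-- An upper bound for `f` follows by subtracting the lower bound for `g` from the upper bound for
`f + g`. -/
theorem tendsto_of_lower_upper {f g s : ℝ → ℝ} {u v : ℝ} (hs : ∀ᶠ y in atTop, 0 < s y)
    (hf : ∀ ε > 0, ∀ᶠ y in atTop, (u - ε) * s y ≤ f y)
    (hg : ∀ ε > 0, ∀ᶠ y in atTop, (v - ε) * s y ≤ g y)
    (hfg : ∀ ε > 0, ∀ᶠ y in atTop, f y + g y ≤ (u + v + ε) * s y) :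
    Tendsto (fun y => f y / s y) atTop (𝓝 u) := by
  refine tendsto_order.2 ⟨fun l hl => ?_, fun r hr => ?_⟩
  · filter_upwards [hs, hf ((u - l) / 2) (by linarith)] with y h1 h2
    rw [lt_div_iff₀ h1]
    nlinarith
  · filter_upwards [hs, hg ((r - u) / 4) (by linarith), hfg ((r - u) / 4) (by linarith)]
      with y h1 h2 h3
    rw [div_lt_iff₀ h1]
    nlinarith

end ModulatedWalk

open ModulatedWalk in
theorem theorem2 {E Ω : Type*} [MeasurableSpace E] [MeasurableSpace Ω]
    -- the modulated random walk
    (Pr : Measure Ω) [IsProbabilityMeasure Pr] (P : Kernel E ℝ) [IsMarkovKernel P]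
    (X : ℕ → Ω → E) (ξ : ℕ → E → Ω → ℝ) (hmod : ModulatedWalk.IsModulated Pr P X ξ)
    -- each `F_x` has a finite mean
    (hmean : ∀ x, Integrable (fun t : ℝ => t) (P x))
    -- the reference distribution `F` on `[0, ∞)`, with finite mean
    (F : Measure ℝ) [IsProbabilityMeasure F] (hFpos : F (Iio 0) = 0)
    (hFmean : Integrable (fun t : ℝ => t) F)
    -- `F̄_x(y) ∼ c(x) F̄(y)`, read as `F̄_x(y) = o(F̄(y))` if `c(x) = 0`
    (c : E → ℝ) (hc_meas : Measurable c) (hc_nonneg : ∀ x, 0 ≤ c x)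
    (htail : ∀ x, (fun y => ModulatedWalk.tail (P x) y - c x * ModulatedWalk.tail F y)
      =o[atTop] ModulatedWalk.tail F)
    (hcomp : ∃ L : ℝ, ∀ x, ∀ y, 0 ≤ y →
      ModulatedWalk.tail (P x) y ≤ L * ModulatedWalk.tail F y)
    -- (C1)
    (π : Measure E) [IsProbabilityMeasure π] (d : ℕ) (hd : 0 < d)
    (hC1 : ModulatedWalk.ConvergesInMean Pr X d π)
    -- (C2)
    (a : ℝ) (ha : 0 < a) (hC2 : ModulatedWalk.HasDrift Pr X ξ a)
    -- `F^s` is subexponential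
    (hsub : ModulatedWalk.Subexponential (ModulatedWalk.secondTailDist F))
    -- all `F_x` are dominated in tail by a distribution `G` with negative mean
    (hG : ∃ G : Measure ℝ, IsProbabilityMeasure G ∧ Integrable (fun t : ℝ => t) G ∧
      ∫ t, t ∂G < 0 ∧ ∀ x y, ModulatedWalk.tail (P x) y ≤ ModulatedWalk.tail G y)
    (B : Set E) (hB : MeasurableSet B) :
    Tendsto
      (fun y : ℝ =>
        Pr.real {ω | (y : EReal) < ModulatedWalk.walkSup X ξ ω ∧
            X (ModulatedWalk.passageTime X ξ y ω) ω ∈ B} /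
          ModulatedWalk.secondTail F y)
      atTop (𝓝 ((∫ x in B, c x ∂π) / a)) := by
  obtain ⟨𝓗, h⟩ := hmod.exists_isHistory
  obtain ⟨L, hL1, hL⟩ := exists_measure_tail_le hFpos hcomp
  have hL0 : 0 ≤ L := zero_le_one.trans hL1
  have hQ := isIntegratedLaw_of_subexponential hFpos hFmean hsub
  obtain ⟨G₀, hG₀, hG₀int, hG₀neg, hPG₀⟩ := hG
  obtain ⟨G, hGprob, hGint, hGle, hGtail⟩ := exists_law_min_tail hFpos hG₀int hL1
  have hPG : ∀ x y, P x (Ioi y) ≤ G (Ioi y) := fun x y => by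
    rw [hGtail]
    exact le_min ((ENNReal.toReal_le_toReal (measure_ne_top _ _) (measure_ne_top _ _)).1
      (hPG₀ x y)) (hL x y)
  have hGL : ∀ y, G (Ioi y) ≤ ENNReal.ofReal L * F (Ioi y) := fun y =>
    (hGtail y).trans_le (min_le_right _ _)
  have hsecond : ∀ᶠ y in atTop, secondTail F y = (intTail F y).toReal ∧ 0 < secondTail F y := by
    filter_upwards [(tendsto_intTail hFmean).eventually (gt_mem_nhds zero_lt_one),
      hQ.eventually_eq hFmean] with y h1 h2
    rw [secondTail_eq, min_eq_right h1.le]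
    refine ⟨rfl, ENNReal.toReal_pos ?_ (intTail_ne_top hFmean y)⟩
    rw [← h2]
    exact (hQ.pos y).ne'
  have hlower : ∀ A, MeasurableSet A → ∀ ε > 0, ∀ᶠ y : ℝ in atTop,
      ((∫ x in A, c x ∂π) / a - ε) * secondTail F y
        ≤ Pr.real {ω | (y : EReal) < walkSup X ξ ω ∧ X (passageTime X ξ y ω) ω ∈ A} := by
    intro A hA ε hε
    filter_upwards [hsecond, h.eventually_le_measure hQ hFmean hL hL0 htail hd hC1 ha hC2 hA hε]
      with y h1 h2
    have h3 := ENNReal.toReal_mono (measure_ne_top _ _) h2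
    rw [ENNReal.toReal_mul, ← h1.1] at h3
    refine le_trans ?_ h3
    gcongr
    · exact h1.2.le
    · rw [ENNReal.toReal_ofReal']
      exact le_max_left _ _
  have hcint : Integrable c π :=
    integrable_tail_constant hc_meas hc_nonneg hL hL0 hQ.measure_Ioi_pos htail π
  -- The events for `B` and `Bᶜ` partition `M > y`, and the constants `C(B)` and `C(Bᶜ)` add up to
  -- the total mass of `c`.
  refine tendsto_of_lower_upper (hsecond.mono fun y hy => hy.2) (hlower B hB)
    (hlower Bᶜ hB.compl) fun ε hε => ?_
  filter_upwards [hsecond, eventually_ge_atTop 0, h.eventually_measure_exceed_le hQ hFmean hL hL0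
    htail hc_nonneg hd hC1 ha hC2 hGint (hGle.trans_lt hG₀neg) hGL hPG hε] with y h1 hy h2
  have h3 := ENNReal.toReal_mono
    (ENNReal.mul_ne_top ENNReal.ofReal_ne_top (intTail_ne_top hFmean y)) h2
  have hnn : 0 ≤ (∫ x, c x ∂π) / a + ε :=
    add_nonneg (div_nonneg (integral_nonneg hc_nonneg) ha.le) hε.le
  rw [ENNReal.toReal_mul, ← h1.1, ENNReal.toReal_ofReal hnn] at h3
  rw [← add_div, integral_add_compl hB hcint]
  refine le_trans ?_ h3
  rw [← measureReal_union]
  · refine measureReal_mono ?_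
    rintro ω (hω | hω) <;> exact lt_walkSup_iff.1 hω.1
  · exact Set.disjoint_left.2 fun ω h4 h5 => h5.2 h4.2
  · exact h.measurableSet_lt_walkSup hB.compl hy
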